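/- **Setting.** Let $d\ge 1$, $\alpha\ge 0$, $0<\beta\le 1$, $\gamma>0$, and let $C_\alpha,C_\beta,C_\gamma,c_\mu,r_\mu>0$ and $\mu=(\mu_-,\mu_+)$ with $\mu_->0$ be constants. For a distribution $G$ of $(X,Y)$ on $[0,1]^d\times\{0,1\}$ let $G_X$ be the law of $X$ and let $\eta_G(x)=G(Y=1\mid X=x)$ be its regression function (a version of the conditional probability on $\operatorname{supp}(G_X)$, and $1/2$ outside). Let $\lambda$ be Lebesgue measure and $B(x,r)$ the Euclidean ball. The posterior-drift class $\Pi=\Pi(\alpha,C_\alpha,\beta,C_\beta,\gamma,C_\gamma,\mu,c_\mu,r_\mu)$ consists of the pairs $(P,Q)$ of distributions on $[0,1]^d\times\{0,1\}$ such that, for some versions of the regression functions: 1. (relative signal exponent) $(\eta_P(x)-\tfrac12)(\eta_Q(x)-\tfrac12)\ge 0$ and $|\eta_P(x)-\tfrac12|\ge C_\gamma|\eta_Q(x)-\tfrac12|^\gamma$ for all $x\in\operatorname{supp}(P_X)\cup\operatorname{supp}(Q_X)$; 2. (margin) $Q_X(0<|\eta_Q(X)-\tfrac12|<t)\le C_\alpha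 t^\alpha$ for all $t>0$; 3. (smoothness) $|\eta_Q(x_1)-\eta_Q(x_2)|\le C_\beta\|x_1-x_2\|^\beta$ for all $x_1,x_2\in\operatorname{supp}(Q_X)$; 4. (common support, strong density) $P_X$ and $Q_X$ are absolutely continuous with respect to $\lambda$ and have the same support $\Omega$; $\lambda(\Omega\cap B(x,r))\ge c_\mu\lambda(B(x,r))$ for all $x\in\Omega$ and $0<r\le r_\mu$; and the densities $dP_X/d\lambda$ and $dQ_X/d\lambda$ lie strictly between $\mu_-$ and $\mu_+$ (almost everywhere) on $\Omega$. **Classifier.** One observes independent i.i.d. samples $(X_i^P,Y_i^P)_{i\le n_P}$ from $P$ and $(X_i^Q,Y_i^Q)_{i\le n_Q}$ from $Q$, where $n_P,n_Q\ge 0$ are integers with $n_P+n_Q\ge 1$. Let $Y^P_{(i)}(x)$ and $Y^Q_{(i)}(x)$ be the label of the $i$-th nearest covariate to $x$ (Euclidean norm, ties broken by the index) in the $P$-sample and in the $Q$-sample. Put $$N=n_P^{\frac{2\beta+d}{2\gamma\beta+d}}+n_Q,\qquad w_Q=N^{-\frac{\beta}{2\beta+d}},\quad w_P=N^{-\frac{\gamma\beta}{2\beta+d}},\quad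 k_Q=\Big\lfloor n_QN^{-\frac{d}{2\beta+d}}\Big\rfloor,\quad k_P=\Big\lfloor n_PN^{-\frac{d}{2\beta+d}}\Big\rfloor .$$ The two-sample weighted $K$-NN classifier is $\hat f_{NN}(x)=1$ if $$\hat\eta_{NN}(x)=\frac{w_P\sum_{i=1}^{k_P}Y^P_{(i)}(x)+w_Q\sum_{i=1}^{k_Q}Y^Q_{(i)}(x)}{w_Pk_P+w_Qk_Q}>\frac12,$$ and $\hat f_{NN}(x)=0$ otherwise, where $\hat\eta_{NN}(x)=0$ if $k_P=k_Q=0$. For a classifier $f$ let $\mathcal E_Q(f)=Q(Y\ne f(X))-Q(Y\ne f_Q^*(X))$ be the excess risk, where $f_Q^*(x)=0$ if $\eta_Q(x)\le\tfrac12$ and $f_Q^*(x)=1$ otherwise. **Theorem (upper bound).** There is a constant $C>0$, depending only on $d$ and on the parameters of $\Pi$, and not on $n_P$ or $n_Q$, such that for all integers $n_P,n_Q\ge 0$ with $n_P+n_Q\ge 1$ $$\sup_{(P,Q)\in\Pi}\mathbb E\,\mathcal E_Q(\hat f_{NN})\le C\Big(n_P^{\frac{2\beta+d}{2\gamma\beta+d}}+n_Q\Big)^{-\frac{\beta(1+\alpha)}{2\beta+d}},$$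 where $\mathbb E$ is the expectation over the two samples. -/

import Mathlib

open MeasureTheory

noncomputable section

namespace PosteriorDrift

/-- The feature space `ℝ^d` with its Euclidean norm. Labels `0`, `1` are `false`, `true`. -/
abbrev Feat (d : ℕ) : Type := EuclideanSpace ℝ (Fin d)

/-- The numerical value in `{0, 1}` of a label. -/
def label (b : Bool) : ℝ := if b then 1 else 0

/-- `η` is a regression function of the distribution `P` of `(X, Y)`: a version of
`x ↦ P(Y = 1 | X = x)`, equal to `1/2` outside the support of the marginal `P_X = P.fst`. -/
structure IsRegressionFunction {d : ℕ} (P : Measure (Feat d × Bool)) (η : Feat d → ℝ) : Prop where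
  measurable : Measurable η
  mem_Icc : ∀ x, η x ∈ Set.Icc (0 : ℝ) 1
  setIntegral_eq : ∀ A : Set (Feat d), MeasurableSet A →
    ∫ x in A, η x ∂P.fst = P.real (A ×ˢ {true})
  eq_half : ∀ x, x ∉ P.fst.support → η x = 1 / 2

/-- The Bayes classifier: `0` if `η x ≤ 1/2` and `1` otherwise. -/
def bayesClassifier {d : ℕ} (η : Feat d → ℝ) (x : Feat d) : Bool := decide (1 / 2 < η x)

/-- The misclassification risk `R_Q(f) = Q(Y ≠ f(X))`. -/
def risk {d : ℕ} (Q : Measure (Feat d × Bool)) (f : Feat d → Bool) : ℝ :=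
  Q.real {z | z.2 ≠ f z.1}

/-- The excess risk `R_Q(f) - R_Q(f*_Q)`, with `η` the regression function of `Q`. -/
def excessRisk {d : ℕ} (Q : Measure (Feat d × Bool)) (η : Feat d → ℝ) (f : Feat d → Bool) : ℝ :=
  risk Q f - risk Q (bayesClassifier η)

/-- `X ∈ [0,1]^d` almost surely. -/
def SupportedOnCube {d : ℕ} (P : Measure (Feat d × Bool)) : Prop :=
  ∀ᵐ z ∂P, ∀ i, z.1 i ∈ Set.Icc (0 : ℝ) 1

/-- Relative signal exponent `γ` of `P` with respect to `Q`, with constant `Cγ`. -/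
def RelativeSignal {d : ℕ} (γ Cγ : ℝ) (P Q : Measure (Feat d × Bool)) (ηP ηQ : Feat d → ℝ) :
    Prop :=
  ∀ x ∈ P.fst.support ∪ Q.fst.support,
    0 ≤ (ηP x - 1 / 2) * (ηQ x - 1 / 2) ∧ Cγ * |ηQ x - 1 / 2| ^ γ ≤ |ηP x - 1 / 2|

/-- `(β, Cβ)`-Hölder smoothness of `g` on the set `S`. -/
def HolderSmoothOn {d : ℕ} (β Cβ : ℝ) (g : Feat d → ℝ) (S : Set (Feat d)) : Prop :=
  ∀ x₁ ∈ S, ∀ x₂ ∈ S, |g x₁ - g x₂| ≤ Cβ * ‖x₁ - x₂‖ ^ β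

/-- The margin assumption with parameters `α`, `Cα`. Points with `η x = 1/2` are not counted,
so that the condition is implied by the one in which they are. -/
def Margin {d : ℕ} (α Cα : ℝ) (Q : Measure (Feat d × Bool)) (η : Feat d → ℝ) : Prop :=
  ∀ t : ℝ, 0 < t → Q.fst.real {x | 0 < |η x - 1 / 2| ∧ |η x - 1 / 2| < t} ≤ Cα * t ^ α

/-- Absolute continuity, with density strictly between `μm` and `μp` on the support. Densities
are determined up to Lebesgue-null sets only, hence the bounds hold almost everywhere. -/
def DensityBounds {d : ℕ} (μm μp : ℝ) (ν : Measure (Feat d)) : Prop :=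
  ν ≪ volume ∧ ∀ᵐ x ∂(volume.restrict ν.support),
    ENNReal.ofReal μm < ν.rnDeriv volume x ∧ ν.rnDeriv volume x < ENNReal.ofReal μp

/-- Common support and strong density assumption for the marginals `νP`, `νQ`. -/
structure StrongDensity {d : ℕ} (μm μp cμ rμ : ℝ) (νP νQ : Measure (Feat d)) : Prop where
  support_eq : νP.support = νQ.support
  regular : ∀ x ∈ νQ.support, ∀ r : ℝ, 0 < r → r ≤ rμ →
    cμ * volume.real (Metric.closedBall x r) ≤ volume.real (νQ.support ∩ Metric.closedBall x r)
  densityP : DensityBounds μm μp νP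
  densityQ : DensityBounds μm μp νQ

/-- The posterior drift class `Π(α, Cα, β, Cβ, γ, Cγ, (μm, μp), cμ, rμ)`: the pair `(P, Q)`,
with regression functions `ηP`, `ηQ`, belongs to it. -/
structure InClass {d : ℕ} (α Cα β Cβ γ Cγ μm μp cμ rμ : ℝ)
    (P Q : Measure (Feat d × Bool)) (ηP ηQ : Feat d → ℝ) : Prop where
  cubeP : SupportedOnCube P
  cubeQ : SupportedOnCube Q
  regressionP : IsRegressionFunction P ηP
  regressionQ : IsRegressionFunction Q ηQ
  signal : RelativeSignal γ Cγ P Q ηP ηQ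
  margin : Margin α Cα Q ηQ
  smooth : HolderSmoothOn β Cβ ηQ Q.fst.support
  density : StrongDensity μm μp cμ rμ P.fst Q.fst

/-- The sum `Y_(1)(x) + ... + Y_(k)(x)` of the labels of the `k` sample points nearest to `x`.
`Tuple.sort` lists the sample by increasing distance to `x`, ties broken by the index. -/
def nearestLabelSum {d n : ℕ} (k : ℕ) (z : Fin n → Feat d × Bool) (x : Feat d) : ℝ :=
  ∑ i : Fin n,
    if (i : ℕ) < k then label (z (Tuple.sort (fun j => ‖(z j).1 - x‖) i)).2 else 0

/-- The two-sample weighted `K`-NN estimator (with value `0` if no neighbour is used). -/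
def knnEstimator {d nP nQ : ℕ} (wP wQ : ℝ) (kP kQ : ℕ)
    (zP : Fin nP → Feat d × Bool) (zQ : Fin nQ → Feat d × Bool) (x : Feat d) : ℝ :=
  (wP * nearestLabelSum kP zP x + wQ * nearestLabelSum kQ zQ x) / (wP * kP + wQ * kQ)

/-- The two-sample weighted `K`-NN classifier. -/
def knnClassifier {d nP nQ : ℕ} (wP wQ : ℝ) (kP kQ : ℕ)
    (zP : Fin nP → Feat d × Bool) (zQ : Fin nQ → Feat d × Bool) (x : Feat d) : Bool :=
  decide (1 / 2 < knnEstimator wP wQ kP kQ zP zQ x)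

/-- The effective sample size `n_P^((2β+d)/(2γβ+d)) + n_Q`. -/
def effSize (d : ℕ) (β γ : ℝ) (nP nQ : ℕ) : ℝ :=
  (nP : ℝ) ^ ((2 * β + d) / (2 * γ * β + d)) + nQ

/-- The weight of the `Q`-neighbours, `δ = effSize ^ (-β/(2β+d))`. -/
def weightQ (d : ℕ) (β γ : ℝ) (nP nQ : ℕ) : ℝ :=
  effSize d β γ nP nQ ^ (-(β / (2 * β + d)))

/-- The weight of the `P`-neighbours, `effSize ^ (-γβ/(2β+d))`. -/
def weightP (d : ℕ) (β γ : ℝ) (nP nQ : ℕ) : ℝ :=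
  effSize d β γ nP nQ ^ (-(γ * β / (2 * β + d)))

/-- The number of `Q`-neighbours. -/
def numQ (d : ℕ) (β γ : ℝ) (nP nQ : ℕ) : ℕ :=
  ⌊(nQ : ℝ) * effSize d β γ nP nQ ^ (-((d : ℝ) / (2 * β + d)))⌋₊

/-- The number of `P`-neighbours. -/
def numP (d : ℕ) (β γ : ℝ) (nP nQ : ℕ) : ℕ :=
  ⌊(nP : ℝ) * effSize d β γ nP nQ ^ (-((d : ℝ) / (2 * β + d)))⌋₊

/-- The two-sample weighted `K`-NN classifier with the weights and neighbour counts above. -/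
def fNN {d nP nQ : ℕ} (β γ : ℝ)
    (zP : Fin nP → Feat d × Bool) (zQ : Fin nQ → Feat d × Bool) : Feat d → Bool :=
  knnClassifier (weightP d β γ nP nQ) (weightQ d β γ nP nQ) (numP d β γ nP nQ)
    (numQ d β γ nP nQ) zP zQ

/-- The law of two independent i.i.d. samples, of size `nP` from `P` and of size `nQ` from `Q`. -/
def sampleLaw {d : ℕ} (nP nQ : ℕ) (P Q : Measure (Feat d × Bool)) :
    Measure ((Fin nP → Feat d × Bool) × (Fin nQ → Feat d × Bool)) :=
  (Measure.pi fun _ => P).prod (Measure.pi fun _ => Q)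

end PosteriorDrift

end

noncomputable section

namespace PosteriorDrift

/-! ### Measurability of the nearest-neighbour rules -/

/-! Write N for `effSize`, δ for `weightQ` and ζ(x) = |η_Q(x) - 1/2|. By Fubini, the expected excess
risk is the Q_X-integral of 2ζ(x) times the probability of a wrong decision at x
(`ofReal_integral_excessRisk`). It suffices to bound that probability by K (ζ/δ)^(-(α+2)): where ζ
is about 2^j δ, the loss is then of order 2^j δ · 2^(-j(α+2)), the margin condition bounds the mass
by a multiple of (2^j δ)^α, and the products sum geometrically to order δ^(1+α), which is the
claimed rate (`Margin.lintegral_le`).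

Fix x in the support and put T = ζ/δ. On a ball of radius r proportional to ζ^(1/β), smoothness
keeps η_Q on the same side of 1/2 with signal at least ζ/2, and the relative signal exponent puts
η_P on that side with signal at least Cγ (ζ/2)^γ. Strong density gives the ball mass at least A
T^(d/β) N^(-d/(2β+d)) under both marginals, so for large T a Chernoff bound places all chosen
neighbours in the ball (`measure_countNear_lt_floor_le`).

Given the covariates, the labels are independent Bernoulli variables
(`IsRegressionFunction.lintegral_pi`), and an exponential moment bound makes a wrong weighted vote
unlikely (`sampleLaw_wrong_vote_le`). Up to constants the weights are the two signals at ζ = δ, so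
the exponent is of order T^(2 min(1,γ)) (w_P² k_P + w_Q² k_Q). The bracket is bounded below because
one of the two summands of N is at least N/2 (`exists_le_sum_sq_weights`). The resulting
exponentials in T (`InClass.sampleLaw_ne_le`) beat every power of T, and bounded T is absorbed into
K (`exists_sampleLaw_ne_le`). -/

lemma measurableSet_sort_eq {d n : ℕ} (σ : Equiv.Perm (Fin n)) :
    MeasurableSet {p : (Fin n → Feat d × Bool) × Feat d |
      Tuple.sort (fun j => ‖(p.1 j).1 - p.2‖) = σ} := by
  have hdist : ∀ j : Fin n, Measurable
      fun p : (Fin n → Feat d × Bool) × Feat d => ‖(p.1 j).1 - p.2‖ := by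
    intro j
    fun_prop
  -- The sorting permutation is characterised by finitely many comparisons of distances:
  -- monotonicity, and increasing indices along ties.
  have heq : {p : (Fin n → Feat d × Bool) × Feat d |
      Tuple.sort (fun j => ‖(p.1 j).1 - p.2‖) = σ} =
      (⋂ i : Fin n, ⋂ j : Fin n, ⋂ _ : i ≤ j, {p : (Fin n → Feat d × Bool) × Feat d |
        ‖(p.1 (σ i)).1 - p.2‖ ≤ ‖(p.1 (σ j)).1 - p.2‖}) ∩
      (⋂ i : Fin n, ⋂ j : Fin n, ⋂ _ : i < j, {p : (Fin n → Feat d × Bool) × Feat d |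
        ‖(p.1 (σ i)).1 - p.2‖ = ‖(p.1 (σ j)).1 - p.2‖ → σ i < σ j}) := by
    ext p
    simp only [Set.mem_ofPred_eq, Set.mem_inter_iff, Set.mem_iInter]
    rw [eq_comm, Tuple.eq_sort_iff]
    rfl
  rw [heq]
  refine MeasurableSet.inter ?_ ?_
  · exact MeasurableSet.iInter fun i => MeasurableSet.iInter fun j => MeasurableSet.iInter fun _ =>
      measurableSet_le (hdist _) (hdist _)
  · refine MeasurableSet.iInter fun i => MeasurableSet.iInter fun j => MeasurableSet.iInter fun _ => ?_
    by_cases h : σ i < σ j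
    · simp [h]
    · simp only [h, imp_false]
      exact (measurableSet_eq_fun (hdist _) (hdist _)).compl

lemma measurable_label : Measurable label := measurable_of_countable _

/-- Only finitely many rankings occur, each on a measurable set, and for a fixed ranking the sum is
plainly measurable. -/
lemma measurable_nearestLabelSum {d n : ℕ} (k : ℕ) :
    Measurable fun p : (Fin n → Feat d × Bool) × Feat d => nearestLabelSum k p.1 p.2 := by
  have heq : (fun p : (Fin n → Feat d × Bool) × Feat d => nearestLabelSum k p.1 p.2) =
      fun p => ∑ σ : Equiv.Perm (Fin n),
        {p : (Fin n → Feat d × Bool) × Feat d |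
          Tuple.sort (fun j => ‖(p.1 j).1 - p.2‖) = σ}.indicator
          (fun p => ∑ i : Fin n, if (i : ℕ) < k then label (p.1 (σ i)).2 else 0) p := by
    funext p
    simp [Set.indicator_apply, nearestLabelSum]
  rw [heq]
  refine Finset.measurable_sum _ fun σ _ => Measurable.indicator ?_ (measurableSet_sort_eq σ)
  refine Finset.measurable_sum _ fun i _ => ?_
  split_ifs
  · exact measurable_label.comp (by fun_prop)
  · exact measurable_const

lemma measurable_fNN {d nP nQ : ℕ} (β γ : ℝ) :
    Measurable fun p : ((Fin nP → Feat d × Bool) × (Fin nQ → Feat d × Bool)) × Feat d =>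
      fNN β γ p.1.1 p.1.2 p.2 := by
  have hP : Measurable fun p : ((Fin nP → Feat d × Bool) × (Fin nQ → Feat d × Bool)) × Feat d =>
      nearestLabelSum (numP d β γ nP nQ) p.1.1 p.2 :=
    (measurable_nearestLabelSum _).comp
      (f := fun p : ((Fin nP → Feat d × Bool) × (Fin nQ → Feat d × Bool)) × Feat d =>
        (p.1.1, p.2)) (by fun_prop)
  have hQ : Measurable fun p : ((Fin nP → Feat d × Bool) × (Fin nQ → Feat d × Bool)) × Feat d =>
      nearestLabelSum (numQ d β γ nP nQ) p.1.2 p.2 :=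
    (measurable_nearestLabelSum _).comp
      (f := fun p : ((Fin nP → Feat d × Bool) × (Fin nQ → Feat d × Bool)) × Feat d =>
        (p.1.2, p.2)) (by fun_prop)
  refine measurable_to_bool ?_
  have hE := ((hP.const_mul (weightP d β γ nP nQ)).add
    (hQ.const_mul (weightQ d β γ nP nQ))).div_const
      (weightP d β γ nP nQ * numP d β γ nP nQ + weightQ d β γ nP nQ * numQ d β γ nP nQ)
  convert measurableSet_lt (measurable_const (a := (1 / 2 : ℝ))) hE using 1
  ext p
  simp [fNN, knnClassifier, knnEstimator]

lemma measurable_bayesClassifier {d : ℕ} {η : Feat d → ℝ} (hη : Measurable η) :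
    Measurable (bayesClassifier η) := by
  refine measurable_to_bool ?_
  convert measurableSet_lt (measurable_const (a := (1 / 2 : ℝ))) hη using 1
  ext p
  simp [bayesClassifier]

/-! ### Labelled samples -/

/-- The conditional probability of the label `b` under the regression function value `p`. -/
def labelProb (p : ℝ) (b : Bool) : ENNReal := ENNReal.ofReal (if b then p else 1 - p)

lemma measurable_labelProb (b : Bool) : Measurable fun p => labelProb p b := by
  unfold labelProb
  cases b <;> simp <;> fun_prop

lemma IsRegressionFunction.measurable_labelProb_comp {d : ℕ} {P : Measure (Feat d × Bool)}
    {η : Feat d → ℝ} (hη : IsRegressionFunction P η) (b : Bool) :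
    Measurable fun x => labelProb (η x) b :=
  (measurable_labelProb b).comp hη.measurable

lemma labelProb_add {p : ℝ} (hp : p ∈ Set.Icc (0 : ℝ) 1) :
    labelProb p true + labelProb p false = 1 := by
  simp only [labelProb, if_true, Bool.false_eq_true, if_false]
  rw [← ENNReal.ofReal_add hp.1 (by linarith [hp.2])]
  simp

lemma lintegral_pi_prod {E : Type*} [MeasurableSpace E] {n : ℕ} (ν : Measure E)
    [IsProbabilityMeasure ν] (g : Fin n → E → ENNReal) (hg : ∀ i, Measurable (g i)) :
    ∫⁻ X, ∏ i, g i (X i) ∂(Measure.pi fun _ : Fin n => ν) = ∏ i, ∫⁻ x, g i x ∂ν := by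
  have hind := ProbabilityTheory.iIndepFun_pi (μ := fun _ : Fin n => ν) (X := g)
    (fun i => (hg i).aemeasurable)
  rw [ProbabilityTheory.lintegral_prod_eq_prod_lintegral_of_indepFun Finset.univ _ hind
    (fun i => (hg i).comp (measurable_pi_apply i))]
  refine Finset.prod_congr rfl fun i _ => ?_
  exact (measurePreserving_eval (fun _ : Fin n => ν) i).lintegral_comp (hg i)

section Regression

variable {d : ℕ} {P : Measure (Feat d × Bool)} [IsProbabilityMeasure P] {η : Feat d → ℝ}

lemma IsRegressionFunction.integrable (hη : IsRegressionFunction P η) :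
    Integrable η P.fst := by
  refine Integrable.of_bound hη.measurable.aestronglyMeasurable 1 (ae_of_all _ fun x => ?_)
  rw [Real.norm_eq_abs, abs_le]
  constructor <;> linarith [(hη.mem_Icc x).1, (hη.mem_Icc x).2]

lemma IsRegressionFunction.measure_prod_true (hη : IsRegressionFunction P η)
    {A : Set (Feat d)} (hA : MeasurableSet A) :
    P (A ×ˢ {true}) = ∫⁻ x in A, labelProb (η x) true ∂P.fst := by
  have h := hη.setIntegral_eq A hA
  rw [← ENNReal.ofReal_toReal (measure_ne_top P (A ×ˢ {true}))]
  change ENNReal.ofReal (P.real (A ×ˢ {true})) = _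
  rw [← h, ofReal_integral_eq_lintegral_ofReal hη.integrable.integrableOn
    (ae_of_all _ fun x => (hη.mem_Icc x).1)]
  simp [labelProb]

lemma IsRegressionFunction.measure_prod_singleton (hη : IsRegressionFunction P η)
    {A : Set (Feat d)} (hA : MeasurableSet A) (b : Bool) :
    P (A ×ˢ {b}) = ∫⁻ x in A, labelProb (η x) b ∂P.fst := by
  cases b with
  | true => exact hη.measure_prod_true hA
  | false =>
    have hsplit : P.fst A = P (A ×ˢ {true}) + P (A ×ˢ {false}) := by
      rw [Measure.fst_apply hA, ← measure_union _ (hA.prod (measurableSet_singleton _))]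
      · congr 1
        ext ⟨x, b⟩
        cases b <;> simp
      · rw [Set.disjoint_left]
        rintro ⟨x, b⟩ h1 h2
        simp_all
    have hsum : P.fst A = ∫⁻ x in A, labelProb (η x) true ∂P.fst
        + ∫⁻ x in A, labelProb (η x) false ∂P.fst := by
      rw [← lintegral_add_left (hη.measurable_labelProb_comp true)]
      simp_rw [labelProb_add (hη.mem_Icc _)]
      simp
    rw [← hη.measure_prod_true hA, hsplit] at hsum
    exact (ENNReal.add_right_inj (measure_ne_top _ _)).mp hsum

lemma IsRegressionFunction.measure_eq (hη : IsRegressionFunction P η)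
    {s : Set (Feat d × Bool)} (hs : MeasurableSet s) :
    P s = ∫⁻ x, ∑ b, labelProb (η x) b * s.indicator 1 (x, b) ∂P.fst := by
  have hm : ∀ b, MeasurableSet {x | (x, b) ∈ s} := fun b => measurable_prodMk_right hs
  have hsplit : s = {x | (x, true) ∈ s} ×ˢ {true} ∪ {x | (x, false) ∈ s} ×ˢ {false} := by
    ext ⟨x, b⟩
    cases b <;> simp
  have hP : P s = P ({x | (x, true) ∈ s} ×ˢ {true}) + P ({x | (x, false) ∈ s} ×ˢ {false}) := by
    conv_lhs => rw [hsplit]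
    refine measure_union ?_ ((hm _).prod (measurableSet_singleton _))
    rw [Set.disjoint_left]
    rintro ⟨x, b⟩ h1 h2
    exact absurd (h1.2.symm.trans h2.2) (by simp)
  rw [hP, hη.measure_prod_singleton (hm _), hη.measure_prod_singleton (hm _),
    ← lintegral_indicator (hm _), ← lintegral_indicator (hm _), ← lintegral_add_left
      ((hη.measurable_labelProb_comp true).indicator (hm _))]
  refine lintegral_congr fun x => ?_
  have hb : ∀ b, {x | (x, b) ∈ s}.indicator (fun x => labelProb (η x) b) x =
      labelProb (η x) b * s.indicator 1 (x, b) := by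
    intro b
    by_cases h : (x, b) ∈ s
    · rw [Set.indicator_of_mem (show x ∈ {x | (x, b) ∈ s} from h), Set.indicator_of_mem h]
      simp
    · rw [Set.indicator_of_notMem (show x ∉ {x | (x, b) ∈ s} from h), Set.indicator_of_notMem h]
      simp
  rw [hb, hb, Fintype.sum_bool]

/-- Conditionally on the covariates, the labels are independent Bernoulli variables. -/
lemma IsRegressionFunction.lintegral_pi (hη : IsRegressionFunction P η) {n : ℕ}
    {F : (Fin n → Feat d × Bool) → ENNReal} (hF : Measurable F) :
    ∫⁻ z, F z ∂(Measure.pi fun _ : Fin n => P) =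
      ∫⁻ X, ∑ b : Fin n → Bool, (∏ j, labelProb (η (X j)) (b j)) * F (fun j => (X j, b j))
        ∂(Measure.pi fun _ : Fin n => P.fst) := by
  have hpair : ∀ b : Fin n → Bool, Measurable fun (X : Fin n → Feat d) (j : Fin n) => (X j, b j) :=
    fun b => by fun_prop
  have hdens : ∀ b : Fin n → Bool,
      Measurable fun X : Fin n → Feat d => ∏ j, labelProb (η (X j)) (b j) := fun b =>
    Finset.measurable_prod _ fun j _ =>
    (hη.measurable_labelProb_comp (b j)).comp (measurable_pi_apply j)
  -- Candidate law: draw the covariates, then give each label vector its conditional product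
  -- probability. It is identified with the product measure on boxes, where the sum over label
  -- vectors factors over coordinates.
  set M : Measure (Fin n → Feat d × Bool) := Measure.sum fun b : Fin n → Bool =>
    ((Measure.pi fun _ : Fin n => P.fst).withDensity
      (fun X => ∏ j, labelProb (η (X j)) (b j))).map (fun X j => (X j, b j)) with hM
  have hMint : ∀ G : (Fin n → Feat d × Bool) → ENNReal, Measurable G → ∫⁻ z, G z ∂M =
      ∫⁻ X, ∑ b : Fin n → Bool, (∏ j, labelProb (η (X j)) (b j)) * G (fun j => (X j, b j))
        ∂(Measure.pi fun _ : Fin n => P.fst) := by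
    intro G hG
    rw [hM, lintegral_sum_measure, tsum_fintype, lintegral_finsetSum]
    · refine Finset.sum_congr rfl fun b _ => ?_
      rw [lintegral_map hG (hpair b), lintegral_withDensity_eq_lintegral_mul _ (hdens b)
        (g := fun X => G fun j => (X j, b j)) (hG.comp (hpair b))]
      rfl
    · exact fun b _ => (hdens b).mul (hG.comp (hpair b))
  have hPM : (Measure.pi fun _ : Fin n => P) = M := by
    refine (Measure.pi_eq fun s hs => ?_)
    have hms : MeasurableSet (Set.univ.pi s) := MeasurableSet.univ_pi hs
    rw [← lintegral_indicator_one hms, hMint _ (measurable_one.indicator hms)]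
    have hterm : ∀ X : Fin n → Feat d, ∑ b : Fin n → Bool, (∏ j, labelProb (η (X j)) (b j)) *
        (Set.univ.pi s).indicator 1 (fun j => (X j, b j)) =
        ∏ j, ∑ b, labelProb (η (X j)) b * (s j).indicator 1 (X j, b) := by
      intro X
      rw [Finset.prod_univ_sum, Fintype.piFinset_univ]
      refine Finset.sum_congr rfl fun b _ => ?_
      rw [Finset.prod_mul_distrib]
      congr 1
      by_cases h : ∀ j, (X j, b j) ∈ s j
      · rw [Set.indicator_of_mem (by simpa using h)]
        simp [h]
      · rw [Set.indicator_of_notMem (by simpa using h)]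
        push Not at h
        obtain ⟨j, hj⟩ := h
        exact (Finset.prod_eq_zero (Finset.mem_univ j) (by simp [hj])).symm
    simp_rw [hterm]
    rw [lintegral_pi_prod P.fst (fun j x => ∑ b, labelProb (η x) b * (s j).indicator 1 (x, b))]
    · exact Finset.prod_congr rfl fun j _ => (hη.measure_eq (hs j)).symm
    · intro j
      refine Finset.measurable_sum _ fun b _ => ?_
      exact ((measurable_labelProb b).comp hη.measurable).mul
        ((measurable_one.indicator (hs j)).comp measurable_prodMk_right)
  rw [hPM, hMint F hF]

end Regression

/-! ### The excess risk as an integral -/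

section ExcessRisk

variable {d : ℕ} {Q : Measure (Feat d × Bool)} [IsProbabilityMeasure Q] {η : Feat d → ℝ}

/-- The indicator that `f` and `g` disagree. -/
def disagree (b c : Bool) : ℝ := if b = c then 0 else 1

lemma disagree_mem_Icc (b c : Bool) : disagree b c ∈ Set.Icc (0 : ℝ) 1 := by
  unfold disagree; split_ifs <;> simp

lemma measurable_disagree {X : Type*} [MeasurableSpace X] {f g : X → Bool} (hf : Measurable f)
    (hg : Measurable g) : Measurable fun x => disagree (f x) (g x) :=
  (measurable_of_countable fun p : Bool × Bool => disagree p.1 p.2).comp (hf.prodMk hg)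

lemma risk_eq_integral (hη : IsRegressionFunction Q η) {f : Feat d → Bool} (hf : Measurable f) :
    risk Q f = ∫ x, (if f x then 1 - η x else η x) ∂Q.fst := by
  have hs : MeasurableSet {z : Feat d × Bool | z.2 ≠ f z.1} :=
    (measurableSet_eq_fun measurable_snd (hf.comp measurable_fst)).compl
  have hft : MeasurableSet {x | f x = true} := hf (measurableSet_singleton true)
  rw [risk, Measure.real, hη.measure_eq hs, integral_eq_lintegral_of_nonneg_ae]
  · congr 1
    refine lintegral_congr fun x => ?_
    cases h : f x <;> simp [Set.indicator_apply, h, labelProb]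
  · refine ae_of_all _ fun x => ?_
    have := hη.mem_Icc x
    simp only [Pi.zero_apply]
    split_ifs <;> linarith [this.1, this.2]
  · exact (Measurable.ite hft (measurable_const.sub hη.measurable)
      hη.measurable).aestronglyMeasurable

/-- The conditional error probabilities of the two labels are η and 1 - η; they differ by 2|η -
1/2|, and the Bayes rule picks the smaller. -/
lemma excessRisk_eq_integral (hη : IsRegressionFunction Q η) {f : Feat d → Bool}
    (hf : Measurable f) : excessRisk Q η f =
      ∫ x, 2 * |η x - 1 / 2| * disagree (f x) (bayesClassifier η x) ∂Q.fst := by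
  have hint : ∀ g : Feat d → Bool, Measurable g →
      Integrable (fun x => if g x then 1 - η x else η x) Q.fst := by
    intro g hg
    have hft : MeasurableSet {x | g x = true} := hg (measurableSet_singleton true)
    refine Integrable.of_bound (Measurable.ite hft (measurable_const.sub hη.measurable)
      hη.measurable).aestronglyMeasurable 1 (ae_of_all _ fun x => ?_)
    have := hη.mem_Icc x
    rw [Real.norm_eq_abs, abs_le]
    split_ifs <;> constructor <;> linarith [this.1, this.2]
  have hb := measurable_bayesClassifier hη.measurable
  rw [excessRisk, risk_eq_integral hη hf, risk_eq_integral hη hb,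
    ← integral_sub (hint f hf) (hint _ hb)]
  refine integral_congr_ae (ae_of_all _ fun x => ?_)
  by_cases h : 1 / 2 < η x
  · have hbx : bayesClassifier η x = true := by simpa [bayesClassifier] using h
    cases hfx : f x <;> simp [hbx, hfx, disagree]
    rw [abs_of_nonneg (by norm_num at h ⊢; linarith)]
    ring
  · have hbx : bayesClassifier η x = false := by simpa [bayesClassifier] using h
    cases hfx : f x <;> simp [hbx, hfx, disagree]
    rw [abs_of_nonpos (by norm_num at h ⊢; linarith)]
    ring

lemma integrable_excessRisk_integrand (hη : IsRegressionFunction Q η) {Z : Type*}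
    [MeasurableSpace Z] (ρ : Measure Z) [IsProbabilityMeasure ρ] {f : Z → Feat d → Bool}
    (hf : Measurable fun p : Z × Feat d => f p.1 p.2) :
    Integrable (fun p : Z × Feat d =>
      2 * |η p.2 - 1 / 2| * disagree (f p.1 p.2) (bayesClassifier η p.2)) (ρ.prod Q.fst) := by
  have hb := measurable_bayesClassifier hη.measurable
  have hm : Measurable fun p : Z × Feat d =>
      2 * |η p.2 - 1 / 2| * disagree (f p.1 p.2) (bayesClassifier η p.2) := by
    have h1 : Measurable fun p : Z × Feat d => η p.2 - 1 / 2 :=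
      (hη.measurable.comp measurable_snd).sub_const _
    exact ((continuous_abs.measurable.comp h1).const_mul 2).mul
      (measurable_disagree hf (hb.comp measurable_snd))
  refine Integrable.of_bound hm.aestronglyMeasurable 1 (ae_of_all _ fun p => ?_)
  have h1 := hη.mem_Icc p.2
  have h2 := disagree_mem_Icc (f p.1 p.2) (bayesClassifier η p.2)
  have h3 : |η p.2 - 1 / 2| ≤ 1 / 2 := by
    rw [abs_le]; constructor <;> linarith [h1.1, h1.2]
  have h4 := abs_nonneg (η p.2 - 1 / 2)
  rw [Real.norm_eq_abs, abs_of_nonneg (by have := h2.1; positivity)]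
  calc 2 * |η p.2 - 1 / 2| * disagree (f p.1 p.2) (bayesClassifier η p.2)
      ≤ 2 * (1 / 2) * 1 := by gcongr <;> [exact h2.1; exact h2.2]
    _ = 1 := by norm_num

lemma integrable_excessRisk (hη : IsRegressionFunction Q η) {Z : Type*}
    [MeasurableSpace Z] (ρ : Measure Z) [IsProbabilityMeasure ρ] {f : Z → Feat d → Bool}
    (hf : Measurable fun p : Z × Feat d => f p.1 p.2) :
    Integrable (fun z => excessRisk Q η (f z)) ρ := by
  simp_rw [fun z => excessRisk_eq_integral hη (f := f z) (hf.comp measurable_prodMk_left)]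
  exact (integrable_excessRisk_integrand hη ρ hf).integral_prod_left

lemma ofReal_integral_excessRisk (hη : IsRegressionFunction Q η) {Z : Type*}
    [MeasurableSpace Z] (ρ : Measure Z) [IsProbabilityMeasure ρ] {f : Z → Feat d → Bool}
    (hf : Measurable fun p : Z × Feat d => f p.1 p.2) :
    ENNReal.ofReal (∫ z, excessRisk Q η (f z) ∂ρ) =
      ∫⁻ x, ENNReal.ofReal (2 * |η x - 1 / 2|) * ρ {z | f z x ≠ bayesClassifier η x} ∂Q.fst := by
  have hint := integrable_excessRisk_integrand hη ρ hf
  simp_rw [fun z => excessRisk_eq_integral hη (f := f z) (hf.comp measurable_prodMk_left)]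
  rw [integral_integral_symm (f := fun z x =>
    2 * |η x - 1 / 2| * disagree (f z x) (bayesClassifier η x)) hint,
    ofReal_integral_eq_lintegral_ofReal]
  · rw [lintegral_prod]
    · refine lintegral_congr fun x => ?_
      have hs : MeasurableSet {z | f z x ≠ bayesClassifier η x} :=
        (measurableSet_eq_fun (hf.comp measurable_prodMk_right) measurable_const).compl
      rw [← lintegral_indicator_one hs, ← lintegral_const_mul _ (measurable_one.indicator hs)]
      refine lintegral_congr fun z => ?_
      rw [ENNReal.ofReal_mul (by positivity)]
      congr 1
      by_cases h : f z x = bayesClassifier η x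
      · simp [h, disagree]
      · simp [h, disagree]
    · exact hint.swap.aestronglyMeasurable.aemeasurable.ennreal_ofReal
  · exact hint.swap
  · refine ae_of_all _ fun p => ?_
    exact mul_nonneg (by positivity) (disagree_mem_Icc _ _).1

end ExcessRisk

/-! ### Integration under the margin condition -/

section MarginIntegral

variable {d : ℕ} {Q : Measure (Feat d × Bool)} [IsProbabilityMeasure Q] {η : Feat d → ℝ}
  {α Cα K δ : ℝ}

/-- The height of the `j`-th dyadic shell of the signal strength. -/
def shellHeight (α K δ : ℝ) (j : ℕ) : ℝ :=
  2 * 2 ^ (α + 2) * K * δ * 2 ^ j * ((2 : ℝ) ^ j) ^ (-(α + 2))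

/-- Take the least j with s < 2^j δ. If j = 0, the trivial bound p ≤ 1 suffices; otherwise s ≥
2^(j-1) δ, and the decay of p applies at the cost of the factor 2^(α+2). -/
lemma exists_shell (hα : 0 ≤ α) (hK : 1 ≤ K) (hδ : 0 < δ) {s p : ℝ} (hs : 0 < s) (hp1 : p ≤ 1)
    (hp : p ≤ K * (s / δ) ^ (-(α + 2))) :
    ∃ j : ℕ, s < 2 ^ j * δ ∧ 2 * s * p ≤ shellHeight α K δ j := by
  have hex : ∃ j : ℕ, s < 2 ^ j * δ := by
    obtain ⟨j, hj⟩ := pow_unbounded_of_one_lt (s / δ) (one_lt_two)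
    exact ⟨j, (div_lt_iff₀ hδ).mp hj⟩
  classical
  obtain ⟨hj, hmin⟩ : s < 2 ^ Nat.find hex * δ ∧ ∀ m < Nat.find hex, ¬ s < 2 ^ m * δ :=
    ⟨Nat.find_spec hex, fun m hm => Nat.find_min hex hm⟩
  refine ⟨Nat.find hex, hj, ?_⟩
  generalize Nat.find hex = j at hj hmin
  cases j with
  | zero =>
    have h1 : (1 : ℝ) ≤ 2 ^ (α + 2) := Real.one_le_rpow one_le_two (by linarith)
    have h2 : 1 ≤ 2 ^ (α + 2) * K := one_le_mul_of_one_le_of_one_le h1 hK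
    simp only [shellHeight, pow_zero, Real.one_rpow, one_mul, mul_one] at hj ⊢
    calc 2 * s * p ≤ 2 * s * 1 := by gcongr
      _ ≤ 2 * δ * (2 ^ (α + 2) * K) := by gcongr
      _ = _ := by ring
  | succ m =>
    have hm : 2 ^ m ≤ s / δ := by
      rw [le_div_iff₀ hδ]; exact not_lt.mp (hmin m (Nat.lt_succ_self m))
    have hmono : (s / δ) ^ (-(α + 2)) ≤ ((2 : ℝ) ^ m) ^ (-(α + 2)) :=
      Real.rpow_le_rpow_of_nonpos (by positivity) hm (by linarith)
    have hsplit : ((2 : ℝ) ^ m) ^ (-(α + 2)) =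
        2 ^ (α + 2) * ((2 : ℝ) ^ (m + 1)) ^ (-(α + 2)) := by
      rw [pow_succ, Real.mul_rpow (by positivity) (by positivity), mul_comm, mul_assoc,
        ← Real.rpow_add two_pos]
      simp
    calc 2 * s * p ≤ 2 * (2 ^ (m + 1) * δ) * (K * ((2 : ℝ) ^ m) ^ (-(α + 2))) := by
          have h0 : p ≤ K * ((2 : ℝ) ^ m) ^ (-(α + 2)) := hp.trans (by gcongr)
          calc 2 * s * p ≤ 2 * s * (K * ((2 : ℝ) ^ m) ^ (-(α + 2))) := by gcongr
            _ ≤ _ := by gcongr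
      _ = shellHeight α K δ (m + 1) := by rw [hsplit, shellHeight]; ring

lemma shellHeight_nonneg (hK : 1 ≤ K) (hδ : 0 < δ) (j : ℕ) : 0 ≤ shellHeight α K δ j := by
  unfold shellHeight; positivity

/-- The powers of 2^j combine to 1 - (α+2) + α = -1. The decay order α + 2 is chosen to leave this
geometric factor. -/
lemma shellHeight_mul (hδ : 0 < δ) (j : ℕ) :
    shellHeight α K δ j * (Cα * (2 ^ j * δ) ^ α) =
      2 * 2 ^ (α + 2) * K * Cα * δ ^ (1 + α) * (1 / 2) ^ j := by
  have h2 : (0 : ℝ) < 2 ^ j := by positivity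
  have hexp : (2 : ℝ) ^ j * ((2 : ℝ) ^ j) ^ (-(α + 2)) * ((2 : ℝ) ^ j) ^ α = (1 / 2) ^ j := by
    rw [mul_assoc, ← Real.rpow_add h2]
    have : (-(α + 2) + α) = -2 := by ring
    rw [this, Real.rpow_neg h2.le, Real.rpow_two, one_div, inv_pow]
    field_simp
  rw [shellHeight, Real.mul_rpow h2.le hδ.le, Real.rpow_add hδ, Real.rpow_one, ← hexp]
  ring

/-- If the probability `p` of a wrong decision decays like a power of the signal strength at scale
`δ`, the margin condition bounds the expected loss by a multiple of `δ ^ (1 + α)`. -/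
lemma Margin.lintegral_le (hmargin : Margin α Cα Q η) (hη : Measurable η) (hα : 0 ≤ α)
    (hCα : 0 < Cα) (hK : 1 ≤ K) (hδ : 0 < δ) {p : Feat d → ENNReal} (hp1 : ∀ x, p x ≤ 1)
    (hp : ∀ᵐ x ∂Q.fst, 0 < |η x - 1 / 2| →
      p x ≤ ENNReal.ofReal (K * (|η x - 1 / 2| / δ) ^ (-(α + 2)))) :
    ∫⁻ x, ENNReal.ofReal (2 * |η x - 1 / 2|) * p x ∂Q.fst ≤
      ENNReal.ofReal (4 * 2 ^ (α + 2) * K * Cα * δ ^ (1 + α)) := by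
  have hζ : Measurable fun x => |η x - 1 / 2| := (hη.sub_const _).abs
  set S : ℕ → Set (Feat d) := fun j => {x | 0 < |η x - 1 / 2| ∧ |η x - 1 / 2| < 2 ^ j * δ} with hS
  have hSm : ∀ j, MeasurableSet (S j) := fun j =>
    (measurableSet_lt measurable_const hζ).inter (measurableSet_lt hζ measurable_const)
  have hpt : ∀ᵐ x ∂Q.fst, ENNReal.ofReal (2 * |η x - 1 / 2|) * p x ≤
      ∑' j, (S j).indicator (fun _ => ENNReal.ofReal (shellHeight α K δ j)) x := by
    filter_upwards [hp] with x hx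
    -- Points with η = 1/2 cost nothing, which is why the margin condition may ignore them.
    rcases (abs_nonneg (η x - 1 / 2)).eq_or_lt' with h0 | h0
    · rw [h0]
      simp
    · have hne : p x ≠ ⊤ := ne_top_of_le_ne_top ENNReal.one_ne_top (hp1 x)
      obtain ⟨j, hj, hle⟩ := exists_shell (p := (p x).toReal) hα hK hδ h0
        (ENNReal.toReal_le_of_le_ofReal zero_le_one (by simpa using hp1 x))
        (ENNReal.toReal_le_of_le_ofReal (by positivity) (hx h0))
      refine le_trans ?_ (ENNReal.le_tsum j)
      rw [Set.indicator_of_mem (show x ∈ S j from ⟨h0, hj⟩), ← ENNReal.ofReal_toReal hne,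
        ← ENNReal.ofReal_mul (by positivity)]
      exact ENNReal.ofReal_le_ofReal hle
  calc ∫⁻ x, ENNReal.ofReal (2 * |η x - 1 / 2|) * p x ∂Q.fst
      ≤ ∫⁻ x, ∑' j, (S j).indicator (fun _ => ENNReal.ofReal (shellHeight α K δ j)) x ∂Q.fst :=
        lintegral_mono_ae hpt
    _ = ∑' j, ENNReal.ofReal (shellHeight α K δ j) * Q.fst (S j) := by
        rw [lintegral_tsum fun j => (measurable_const.indicator (hSm j)).aemeasurable]
        exact tsum_congr fun j => lintegral_indicator_const (hSm j) _
    _ ≤ ∑' j : ℕ, ENNReal.ofReal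
          (2 * 2 ^ (α + 2) * K * Cα * δ ^ (1 + α) * (1 / 2) ^ j) := by
        refine ENNReal.tsum_le_tsum fun j => ?_
        rw [← shellHeight_mul hδ, ENNReal.ofReal_mul (shellHeight_nonneg hK hδ j)]
        gcongr
        rw [← ofReal_measureReal]
        exact ENNReal.ofReal_le_ofReal (hmargin _ (by positivity))
    _ = ENNReal.ofReal (4 * 2 ^ (α + 2) * K * Cα * δ ^ (1 + α)) := by
        rw [← ENNReal.ofReal_tsum_of_nonneg (fun j => by positivity)
          (summable_geometric_two.mul_left _), tsum_mul_left, tsum_geometric_two]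
        congr 1
        ring

end MarginIntegral

/-! ### The number of sample points in a ball -/

section Count

variable {E : Type*} [MeasurableSpace E] {n : ℕ}

/-- The number of sample points in `B`. -/
def countIn (B : Set E) (z : Fin n → E) : ℕ := ∑ j, B.indicator 1 (z j)

lemma measurable_countIn {B : Set E} (hB : MeasurableSet B) :
    Measurable fun z : Fin n → E => countIn B z :=
  Finset.measurable_sum _ fun j _ => (measurable_one.indicator hB).comp (measurable_pi_apply j)

/-- The integral equals 1 - (1 - e⁻¹) ν(B), and 1 + u ≤ e^u. -/
lemma lintegral_exp_neg_indicator_le (ν : Measure E) [IsProbabilityMeasure ν] {B : Set E}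
    (hB : MeasurableSet B) :
    ∫⁻ x, ENNReal.ofReal (Real.exp (-(B.indicator 1 x : ℕ))) ∂ν ≤
      ENNReal.ofReal (Real.exp (-(1 - Real.exp (-1)) * ν.real B)) := by
  have heq : ∀ x, ENNReal.ofReal (Real.exp (-(B.indicator 1 x : ℕ))) =
      Bᶜ.indicator (fun _ => 1) x + B.indicator (fun _ => ENNReal.ofReal (Real.exp (-1))) x := by
    intro x
    by_cases h : x ∈ B <;> simp [h]
  simp_rw [heq]
  rw [lintegral_add_left (measurable_const.indicator hB.compl), lintegral_indicator_const hB.compl,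
    lintegral_indicator_const hB, one_mul, ← ofReal_measureReal (s := B),
    ← ofReal_measureReal (s := Bᶜ), ← ENNReal.ofReal_mul (by positivity),
    ← ENNReal.ofReal_add (by positivity) (by positivity), probReal_compl_eq_one_sub hB]
  refine ENNReal.ofReal_le_ofReal ?_
  have := Real.add_one_le_exp (-(1 - Real.exp (-1)) * ν.real B)
  linarith

/-- A Chernoff bound for the lower tail of the number of sample points in `B`. -/
lemma measure_countIn_lt_le (ν : Measure E) [IsProbabilityMeasure ν] {B : Set E}
    (hB : MeasurableSet B) {k : ℕ} {q : ℝ} (hq : q ≤ n * ν.real B) (hk : 2 * k ≤ q) :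
    (Measure.pi fun _ : Fin n => ν) {z | countIn B z < k} ≤
      ENNReal.ofReal (Real.exp (-(q / 10))) := by
  have hs : MeasurableSet {z : Fin n → E | countIn B z < k} :=
    measurable_countIn hB measurableSet_Iio
  have hg : Measurable fun x => ENNReal.ofReal (Real.exp (-(B.indicator 1 x : ℕ))) := by
    have : Measurable fun x => (B.indicator 1 x : ℕ) := measurable_one.indicator hB
    exact (Real.measurable_exp.comp
      ((measurable_of_countable fun m : ℕ => (m : ℝ)).comp this).neg).ennreal_ofReal
  -- Exponential Markov inequality with parameter 1: the indicator is at most exp(k - count).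
  have hpt : ∀ z : Fin n → E, {z | countIn B z < k}.indicator 1 z ≤
      ENNReal.ofReal (Real.exp k) *
        ∏ j, ENNReal.ofReal (Real.exp (-(B.indicator 1 (z j) : ℕ))) := by
    intro z
    rw [← ENNReal.ofReal_prod_of_nonneg (fun _ _ => by positivity), ← Real.exp_sum,
      ← ENNReal.ofReal_mul (by positivity), ← Real.exp_add]
    by_cases h : countIn B z < k
    · rw [Set.indicator_of_mem (show z ∈ {z | countIn B z < k} from h), Pi.one_apply,
        ENNReal.one_le_ofReal, Real.one_le_exp_iff, Finset.sum_neg_distrib]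
      have h' : (countIn B z : ℝ) ≤ k := by exact_mod_cast h.le
      rw [countIn] at h'
      push_cast at h'
      linarith
    · rw [Set.indicator_of_notMem (show z ∉ {z | countIn B z < k} from h)]
      simp
  -- With k ≤ q/2 the final exponent is at most q/2 - 0.63 q, hence below -q/10.
  have he : Real.exp (-1) ≤ 0.37 := by
    have := Real.exp_one_gt_d9
    rw [Real.exp_neg, inv_le_comm₀ (Real.exp_pos _) (by norm_num)]
    norm_num at this ⊢
    linarith
  have hq0 : 0 ≤ q := le_trans (by positivity) hk
  calc (Measure.pi fun _ : Fin n => ν) {z | countIn B z < k}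
      = ∫⁻ z, {z | countIn B z < k}.indicator 1 z ∂(Measure.pi fun _ : Fin n => ν) :=
        (lintegral_indicator_one hs).symm
    _ ≤ ∫⁻ z, ENNReal.ofReal (Real.exp k) *
        ∏ j, ENNReal.ofReal (Real.exp (-(B.indicator 1 (z j) : ℕ)))
          ∂(Measure.pi fun _ : Fin n => ν) := lintegral_mono hpt
    _ = ENNReal.ofReal (Real.exp k) *
        ∏ _j : Fin n, ∫⁻ x, ENNReal.ofReal (Real.exp (-(B.indicator 1 x : ℕ))) ∂ν := by
        rw [lintegral_const_mul _ (f := fun z : Fin n → E =>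
            ∏ j, ENNReal.ofReal (Real.exp (-(B.indicator 1 (z j) : ℕ))))
          (Finset.measurable_prod _ fun j _ => hg.comp (measurable_pi_apply j))]
        rw [lintegral_pi_prod ν _ fun _ => hg]
    _ ≤ ENNReal.ofReal (Real.exp k) *
        ∏ _j : Fin n, ENNReal.ofReal (Real.exp (-(1 - Real.exp (-1)) * ν.real B)) := by
        gcongr
        exact lintegral_exp_neg_indicator_le ν hB
    _ = ENNReal.ofReal (Real.exp (k + n * (-(1 - Real.exp (-1)) * ν.real B))) := by
        rw [Finset.prod_const, ← ENNReal.ofReal_pow (by positivity), ← Real.exp_nat_mul,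
          ← ENNReal.ofReal_mul (by positivity), ← Real.exp_add]
        simp
    _ ≤ _ := by
        refine ENNReal.ofReal_le_ofReal (Real.exp_le_exp.mpr ?_)
        have : (1 - Real.exp (-1)) * q ≤ (1 - Real.exp (-1)) * (n * ν.real B) :=
          mul_le_mul_of_nonneg_left hq (by linarith)
        nlinarith

end Count

/-! ### Nearest neighbours -/

section Neighbours

variable {d n : ℕ}

/-- The number of sample points within distance `r` of `x`. -/
def countNear (r : ℝ) (x : Feat d) (z : Fin n → Feat d × Bool) : ℕ :=
  countIn (Prod.fst ⁻¹' Metric.closedBall x r) z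

lemma measurable_countNear (r : ℝ) (x : Feat d) :
    Measurable fun z : Fin n → Feat d × Bool => countNear r x z :=
  measurable_countIn (measurable_fst Metric.isClosed_closedBall.measurableSet)

lemma countNear_eq_card (r : ℝ) (x : Feat d) (z : Fin n → Feat d × Bool) :
    countNear r x z = (Finset.univ.filter fun j => ‖(z j).1 - x‖ ≤ r).card := by
  rw [Finset.card_filter, countNear, countIn]
  refine Finset.sum_congr rfl fun j _ => ?_
  by_cases h : ‖(z j).1 - x‖ ≤ r
  · rw [Set.indicator_of_mem (by simpa [dist_eq_norm] using h), if_pos h, Pi.one_apply]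
  · rw [Set.indicator_of_notMem (by simpa [dist_eq_norm] using h), if_neg h]

/-- The indices of the sample listed by increasing distance to `x`. -/
def ranking (x : Feat d) (z : Fin n → Feat d × Bool) : Equiv.Perm (Fin n) :=
  Tuple.sort fun j => ‖(z j).1 - x‖

/-- If the point of rank i were farther than r, every point within r would have rank below i,
leaving at most i < k of them. -/
lemma norm_ranking_sub_le {k : ℕ} {r : ℝ} {x : Feat d} {z : Fin n → Feat d × Bool}
    (hk : k ≤ countNear r x z) {i : Fin n} (hi : (i : ℕ) < k) :
    ‖(z (ranking x z i)).1 - x‖ ≤ r := by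
  by_contra! hlt
  have hmono := Tuple.monotone_sort fun j => ‖(z j).1 - x‖
  have hsub : (Finset.univ.filter fun j => ‖(z j).1 - x‖ ≤ r) ⊆
      (Finset.Iio i).map (ranking x z).toEmbedding := by
    intro j hj
    rw [Finset.mem_filter] at hj
    rw [Finset.mem_map]
    refine ⟨(ranking x z).symm j, ?_, by simp⟩
    rw [Finset.mem_Iio]
    by_contra! hle
    have h1 := hmono hle
    have h2 : ‖(z (ranking x z i)).1 - x‖ ≤ ‖(z j).1 - x‖ := by
      simpa [ranking] using h1
    linarith [hj.2]
  have hcard := Finset.card_le_card hsub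
  rw [← countNear_eq_card, Finset.card_map, Fin.card_Iio] at hcard
  omega

lemma sum_ite_lt {k : ℕ} (hk : k ≤ n) (c : ℝ) :
    ∑ i : Fin n, (if (i : ℕ) < k then c else 0) = k * c := by
  rw [Finset.sum_ite, Finset.sum_const_zero, add_zero, Finset.sum_const, nsmul_eq_mul]
  congr 2
  rw [← Fintype.card_subtype]
  have := Fin.card_filter_val_lt (n := n) (m := k)
  rw [← Fintype.card_subtype] at this
  rw [this, min_eq_right hk]

/-- Reindexing from ranks to sample indices: the ranking depends on the covariates only, so given
these the vote is a sum of independent terms over a fixed index set. -/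
lemma nearestLabelSum_sub_half {k : ℕ} (hk : k ≤ n) (z : Fin n → Feat d × Bool) (x : Feat d) :
    nearestLabelSum k z x - k / 2 =
      ∑ j, if ((ranking x z).symm j : ℕ) < k then label (z j).2 - 1 / 2 else 0 := by
  have h1 : (k : ℝ) / 2 = ∑ i : Fin n, if (i : ℕ) < k then (1 / 2 : ℝ) else 0 := by
    rw [sum_ite_lt hk]; ring
  rw [h1, nearestLabelSum, ← Finset.sum_sub_distrib, ← Equiv.sum_comp (ranking x z)
    fun j => if ((ranking x z).symm j : ℕ) < k then label (z j).2 - 1 / 2 else 0]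
  refine Finset.sum_congr rfl fun i _ => ?_
  rw [Equiv.symm_apply_apply]
  split_ifs <;> simp [ranking]

/-- The left side is cosh y - 2(p - 1/2) sinh y ≤ e^(y²/2) - 2ay. For y ≤ 1 one has e^(y²/2) ≤ 2, so
this is at most e^(y²/2)(1 - ay) ≤ e^(y²/2 - ay). -/
lemma bernoulli_mgf_le {p a y : ℝ} (ha : 0 ≤ a) (hp : a ≤ p - 1 / 2) (hy0 : 0 ≤ y) (hy1 : y ≤ 1) :
    p * Real.exp (-y) + (1 - p) * Real.exp y ≤ Real.exp (y ^ 2 / 2 - a * y) := by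
  have h1 : p * Real.exp (-y) + (1 - p) * Real.exp y =
      Real.cosh y - 2 * (p - 1 / 2) * Real.sinh y := by
    rw [Real.cosh_eq, Real.sinh_eq]; ring
  have h2 := Real.cosh_le_exp_half_sq y
  have h3 : y ≤ Real.sinh y := Real.self_le_sinh_iff.mpr hy0
  have h4 : a * y ≤ (p - 1 / 2) * Real.sinh y := by
    have : 0 ≤ p - 1 / 2 := ha.trans hp
    gcongr
  have h5 : Real.exp (y ^ 2 / 2) ≤ 2 := by
    have h6 : Real.exp (y ^ 2 / 2) ≤ Real.exp (1 / 2) := by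
      rw [Real.exp_le_exp]; nlinarith
    have h7 : Real.exp (1 / 2) ^ 2 = Real.exp 1 := by rw [← Real.exp_nat_mul]; norm_num
    have h8 := Real.exp_one_lt_d9
    nlinarith [Real.exp_pos (1 / 2)]
  have h9 := Real.add_one_le_exp (-(a * y))
  have h10 : 0 ≤ a * y := by positivity
  rw [sub_eq_add_neg (y ^ 2 / 2), Real.exp_add, h1]
  nlinarith [Real.exp_pos (y ^ 2 / 2), mul_le_mul_of_nonneg_left h5 h10,
    mul_le_mul_of_nonneg_left h9 (Real.exp_pos (y ^ 2 / 2)).le]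

/-- A centred label is ±1/2, so `bernoulli_mgf_le` applies with y = t/2; the sign s = -1 exchanges p
and 1 - p. -/
lemma sum_labelProb_mul_exp_le {p a t s : ℝ} (hp : p ∈ Set.Icc (0 : ℝ) 1) (hs : s = 1 ∨ s = -1)
    (ha : 0 ≤ a) (hpa : a ≤ s * (p - 1 / 2)) (ht0 : 0 ≤ t) (ht2 : t ≤ 2) :
    ∑ b, labelProb p b * ENNReal.ofReal (Real.exp (-t * (s * (label b - 1 / 2)))) ≤
      ENNReal.ofReal (Real.exp (t ^ 2 / 8 - t * a / 2)) := by
  have hp1 : 0 ≤ 1 - p := by linarith [hp.2]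
  rw [Fintype.sum_bool]
  simp only [labelProb, label, if_true, Bool.false_eq_true, if_false]
  rw [← ENNReal.ofReal_mul hp.1, ← ENNReal.ofReal_mul hp1, ← ENNReal.ofReal_add
    (mul_nonneg hp.1 (Real.exp_nonneg _)) (mul_nonneg hp1 (Real.exp_nonneg _))]
  refine ENNReal.ofReal_le_ofReal ?_
  rcases hs with rfl | rfl
  · have := bernoulli_mgf_le (p := p) ha (by linarith) (y := t / 2) (by linarith) (by linarith)
    convert this using 3 <;> ring_nf
  · have := bernoulli_mgf_le (p := 1 - p) ha (by linarith) (y := t / 2) (by linarith)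
      (by linarith)
    rw [add_comm]
    convert this using 3 <;> ring_nf

end Neighbours

/-! ### Vote moments and neighbour distances in one sample -/

section OneSample

variable {d n : ℕ} {P : Measure (Feat d × Bool)} [IsProbabilityMeasure P] {η : Feat d → ℝ}

lemma ae_pi_mem_support (ν : Measure (Feat d)) [IsProbabilityMeasure ν] :
    ∀ᵐ X ∂(Measure.pi fun _ : Fin n => ν), ∀ j, X j ∈ ν.support := by
  rw [ae_all_iff]
  intro j
  exact (measurePreserving_eval (fun _ : Fin n => ν) j).quasiMeasurePreserving.ae
    Measure.support_mem_ae

/-- The exponential moment of the votes of the `k` nearest neighbours of `x`, on the event that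
they all lie within distance `r`. -/
lemma IsRegressionFunction.lintegral_exp_votes_le (hη : IsRegressionFunction P η) {k : ℕ}
    (hk : k ≤ n) (x : Feat d) {r a t s : ℝ} (hs : s = 1 ∨ s = -1) (ha : 0 ≤ a)
    (hsig : ∀ u ∈ P.fst.support, ‖u - x‖ ≤ r → a ≤ s * (η u - 1 / 2))
    (ht0 : 0 ≤ t) (ht2 : t ≤ 2) :
    ∫⁻ z, {z | k ≤ countNear r x z}.indicator (fun z =>
        ENNReal.ofReal (Real.exp (-t * (s * (nearestLabelSum k z x - k / 2))))) z
        ∂(Measure.pi fun _ : Fin n => P) ≤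
      ENNReal.ofReal (Real.exp (k * (t ^ 2 / 8 - t * a / 2))) := by
  have hmeas : Measurable fun z : Fin n → Feat d × Bool => nearestLabelSum k z x :=
    (measurable_nearestLabelSum k).comp (f := fun z => (z, x)) (by fun_prop)
  have hG : MeasurableSet {z : Fin n → Feat d × Bool | k ≤ countNear r x z} :=
    measurable_countNear r x measurableSet_Ici
  have hF : Measurable fun z : Fin n → Feat d × Bool =>
      ENNReal.ofReal (Real.exp (-t * (s * (nearestLabelSum k z x - k / 2)))) := by
    fun_prop
  rw [hη.lintegral_pi (hF.indicator hG)]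
  calc _ ≤ ∫⁻ _X, ENNReal.ofReal (Real.exp (k * (t ^ 2 / 8 - t * a / 2)))
        ∂(Measure.pi fun _ : Fin n => P.fst) := ?_
    _ = _ := by simp
  refine lintegral_mono_ae ?_
  filter_upwards [ae_pi_mem_support (n := n) P.fst] with X hX
  by_cases hcount : k ≤ countNear r x fun j => (X j, true)
  swap
  · refine le_of_eq_of_le (Finset.sum_eq_zero fun b _ => ?_) zero_le
    rw [Set.indicator_of_notMem, mul_zero]
    exact hcount
  set ρ := ranking x fun j => (X j, true) with hρ
  have hterm : ∀ b : Fin n → Bool, (∏ j, labelProb (η (X j)) (b j)) *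
      {z | k ≤ countNear r x z}.indicator (fun z => ENNReal.ofReal
        (Real.exp (-t * (s * (nearestLabelSum k z x - k / 2))))) (fun j => (X j, b j)) =
      ∏ j, labelProb (η (X j)) (b j) * ENNReal.ofReal (Real.exp
        (if (ρ.symm j : ℕ) < k then -t * (s * (label (b j) - 1 / 2)) else 0)) := by
    intro b
    rw [Set.indicator_of_mem
        (show (fun j => (X j, b j)) ∈ {z | k ≤ countNear r x z} from hcount),
      nearestLabelSum_sub_half hk, Finset.prod_mul_distrib,
      ← ENNReal.ofReal_prod_of_nonneg (fun _ _ => by positivity), ← Real.exp_sum,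
      Finset.mul_sum, Finset.mul_sum]
    congr 3
    refine Finset.sum_congr rfl fun j _ => ?_
    change (-t * (s * if (ρ.symm j : ℕ) < k then _ else _)) = _
    split_ifs <;> simp
  simp_rw [hterm]
  rw [← Fintype.piFinset_univ, ← Finset.prod_univ_sum (fun _ => Finset.univ) fun j b =>
    labelProb (η (X j)) b * ENNReal.ofReal (Real.exp
      (if (ρ.symm j : ℕ) < k then -t * (s * (label b - 1 / 2)) else 0))]
  calc _ ≤ ∏ j, ENNReal.ofReal (Real.exp
          (if (ρ.symm j : ℕ) < k then t ^ 2 / 8 - t * a / 2 else 0)) := by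
        refine Finset.prod_le_prod' fun j _ => ?_
        by_cases hj : (ρ.symm j : ℕ) < k
        · simp only [hj, if_true]
          refine sum_labelProb_mul_exp_le (hη.mem_Icc _) hs ha (hsig _ (hX j) ?_) ht0 ht2
          have := norm_ranking_sub_le hcount hj
          simpa [← hρ] using this
        -- A point that is not among the k nearest contributes the factor 1.
        · simp only [hj, if_false, Real.exp_zero, ENNReal.ofReal_one, mul_one, Fintype.sum_bool]
          exact (labelProb_add (hη.mem_Icc _)).le
    _ = _ := by
        rw [← ENNReal.ofReal_prod_of_nonneg (fun _ _ => by positivity), ← Real.exp_sum,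
          ← sum_ite_lt hk, Equiv.sum_comp ρ.symm
            (fun i : Fin n => if (i : ℕ) < k then t ^ 2 / 8 - t * a / 2 else 0)]

/-- With high probability, the `k` nearest neighbours of `x` lie within distance `r`. -/
lemma measure_countNear_lt_le (x : Feat d) {k : ℕ} {q r : ℝ}
    (hq : q ≤ n * P.fst.real (Metric.closedBall x r)) (hk : 2 * k ≤ q) :
    (Measure.pi fun _ : Fin n => P) {z | countNear r x z < k} ≤
      ENNReal.ofReal (Real.exp (-(q / 10))) := by
  refine measure_countIn_lt_le P (measurable_fst Metric.isClosed_closedBall.measurableSet) ?_ hk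
  rwa [Measure.real, Measure.fst_apply Metric.isClosed_closedBall.measurableSet] at hq

end OneSample

/-! ### The weighted vote of both samples -/

section TwoSamples

variable {d nP nQ : ℕ} {P Q : Measure (Feat d × Bool)} [IsProbabilityMeasure P]
  [IsProbabilityMeasure Q] {ηP ηQ : Feat d → ℝ}

/-- The weighted vote of the nearest neighbours is unlikely to have the wrong sign. -/
lemma sampleLaw_wrong_vote_le (hηP : IsRegressionFunction P ηP) (hηQ : IsRegressionFunction Q ηQ)
    {kP kQ : ℕ} (hkP : kP ≤ nP) (hkQ : kQ ≤ nQ) (x : Feat d) {r aP aQ wP wQ t s : ℝ}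
    (hs : s = 1 ∨ s = -1) (haP : 0 ≤ aP) (haQ : 0 ≤ aQ)
    (hsigP : ∀ u ∈ P.fst.support, ‖u - x‖ ≤ r → aP ≤ s * (ηP u - 1 / 2))
    (hsigQ : ∀ u ∈ Q.fst.support, ‖u - x‖ ≤ r → aQ ≤ s * (ηQ u - 1 / 2))
    (ht : 0 ≤ t) (hwP : 0 ≤ wP) (hwQ : 0 ≤ wQ) (htP : t * wP ≤ 2) (htQ : t * wQ ≤ 2) :
    sampleLaw nP nQ P Q {z | s * (wP * (nearestLabelSum kP z.1 x - kP / 2) +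
        wQ * (nearestLabelSum kQ z.2 x - kQ / 2)) ≤ 0} ≤
      (Measure.pi fun _ : Fin nP => P) {z | countNear r x z < kP} +
      (Measure.pi fun _ : Fin nQ => Q) {z | countNear r x z < kQ} +
      ENNReal.ofReal (Real.exp (kP * ((t * wP) ^ 2 / 8 - t * wP * aP / 2) +
        kQ * ((t * wQ) ^ 2 / 8 - t * wQ * aQ / 2))) := by
  set fP : (Fin nP → Feat d × Bool) → ENNReal := {z | kP ≤ countNear r x z}.indicator fun z =>
    ENNReal.ofReal (Real.exp (-(t * wP) * (s * (nearestLabelSum kP z x - kP / 2)))) with hfP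
  set fQ : (Fin nQ → Feat d × Bool) → ENNReal := {z | kQ ≤ countNear r x z}.indicator fun z =>
    ENNReal.ofReal (Real.exp (-(t * wQ) * (s * (nearestLabelSum kQ z x - kQ / 2)))) with hfQ
  have hmeas : ∀ (n k : ℕ) (c : ℝ), Measurable
      ({z : Fin n → Feat d × Bool | k ≤ countNear r x z}.indicator fun z =>
        ENNReal.ofReal (Real.exp (-c * (s * (nearestLabelSum k z x - k / 2))))) := by
    intro n k c
    have h1 : Measurable fun z : Fin n → Feat d × Bool => nearestLabelSum k z x :=
      (measurable_nearestLabelSum k).comp (f := fun z => (z, x)) (by fun_prop)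
    exact Measurable.indicator (by fun_prop) (measurable_countNear r x measurableSet_Ici)
  have hmP : Measurable fP := hmeas _ _ _
  have hmQ : Measurable fQ := hmeas _ _ _
  -- When all chosen neighbours are within r, a wrong vote forces the product of the two
  -- exponentials to be at least 1. Markov's inequality and independence of the samples then apply.
  have hsub : {z : (Fin nP → Feat d × Bool) × (Fin nQ → Feat d × Bool) |
      s * (wP * (nearestLabelSum kP z.1 x - kP / 2) +
        wQ * (nearestLabelSum kQ z.2 x - kQ / 2)) ≤ 0} ⊆
      ({z | countNear r x z < kP} ×ˢ Set.univ ∪ Set.univ ×ˢ {z | countNear r x z < kQ}) ∪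
        {z | 1 ≤ fP z.1 * fQ z.2} := by
    rintro ⟨zP, zQ⟩ hz
    by_cases h1 : countNear r x zP < kP
    · exact Or.inl (Or.inl ⟨h1, trivial⟩)
    by_cases h2 : countNear r x zQ < kQ
    · exact Or.inl (Or.inr ⟨trivial, h2⟩)
    · refine Or.inr ?_
      change 1 ≤ fP zP * fQ zQ
      rw [hfP, hfQ, Set.indicator_of_mem (show zP ∈ {z | kP ≤ countNear r x z} from not_lt.mp h1),
        Set.indicator_of_mem (show zQ ∈ {z | kQ ≤ countNear r x z} from not_lt.mp h2),
        ← ENNReal.ofReal_mul (by positivity), ← Real.exp_add, ENNReal.one_le_ofReal,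
        Real.one_le_exp_iff]
      change s * (wP * (nearestLabelSum kP zP x - kP / 2) +
        wQ * (nearestLabelSum kQ zQ x - kQ / 2)) ≤ 0 at hz
      linarith [mul_nonneg ht (neg_nonneg.mpr hz)]
  have hmarkov : sampleLaw nP nQ P Q {z | 1 ≤ fP z.1 * fQ z.2} ≤
      ENNReal.ofReal (Real.exp (kP * ((t * wP) ^ 2 / 8 - t * wP * aP / 2) +
        kQ * ((t * wQ) ^ 2 / 8 - t * wQ * aQ / 2))) := by
    have h1 := meas_ge_le_lintegral_div (μ := sampleLaw nP nQ P Q)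
      (f := fun z => fP z.1 * fQ z.2)
      ((hmP.comp measurable_fst).mul (hmQ.comp measurable_snd)).aemeasurable
      one_ne_zero ENNReal.one_ne_top
    rw [div_one] at h1
    refine h1.trans ?_
    rw [sampleLaw, lintegral_prod_mul hmP.aemeasurable hmQ.aemeasurable, Real.exp_add,
      ENNReal.ofReal_mul (by positivity)]
    exact mul_le_mul'
      (hηP.lintegral_exp_votes_le hkP x hs haP hsigP (mul_nonneg ht hwP) htP)
      (hηQ.lintegral_exp_votes_le hkQ x hs haQ hsigQ (mul_nonneg ht hwQ) htQ)
  refine (measure_mono hsub).trans ((measure_union_le _ _).trans (add_le_add ?_ hmarkov))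
  refine (measure_union_le _ _).trans (le_of_eq ?_)
  rw [sampleLaw, Measure.prod_prod, Measure.prod_prod]
  simp

end TwoSamples

/-! ### Weights and numbers of neighbours -/

section Rates

variable {d nP nQ : ℕ} {β γ : ℝ}

lemma one_le_effSize (hβ : 0 < β) (hγ : 0 < γ) (h : 1 ≤ nP + nQ) :
    1 ≤ effSize d β γ nP nQ := by
  have hd : (0 : ℝ) ≤ d := Nat.cast_nonneg d
  have he : 0 ≤ (2 * β + d) / (2 * γ * β + d) := by positivity
  rcases Nat.eq_zero_or_pos nP with h0 | h0
  · have : (1 : ℝ) ≤ nQ := by exact_mod_cast (by omega : 1 ≤ nQ)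
    exact this.trans (le_add_of_nonneg_left (by positivity))
  · have h1 : (1 : ℝ) ≤ nP := by exact_mod_cast h0
    exact (Real.one_le_rpow h1 he).trans (le_add_of_nonneg_right (by positivity))

lemma floor_mul_rpow_le {N e : ℝ} (hN : 1 ≤ N) (he : 0 ≤ e) (n : ℕ) :
    ⌊(n : ℝ) * N ^ (-e)⌋₊ ≤ n := by
  refine Nat.floor_le_of_le ?_
  have := Real.rpow_le_one_of_one_le_of_nonpos hN (neg_nonpos.mpr he)
  exact mul_le_of_le_one_right (by positivity) this

lemma half_le_sq_mul_floor {b w y : ℝ} (hy : 1 ≤ y) (h : b ≤ w ^ 2 * y) :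
    b / 2 ≤ w ^ 2 * (⌊y⌋₊ : ℝ) := by
  have h1 : y / 2 ≤ (⌊y⌋₊ : ℝ) := by
    have h2 := Nat.lt_floor_add_one y
    have h3 : (1 : ℝ) ≤ (⌊y⌋₊ : ℝ) := by exact_mod_cast Nat.floor_pos.mpr hy
    linarith
  nlinarith [mul_le_mul_of_nonneg_left h1 (sq_nonneg w)]

/-- For large effective sample sizes, the signal-to-noise ratio of the weighted vote is bounded
from below. -/
lemma exists_le_sum_sq_weights (d : ℕ) (hβ : 0 < β) (hγ : 0 < γ) :
    ∃ N₀ c : ℝ, 0 < N₀ ∧ 0 < c ∧ ∀ nP nQ : ℕ, N₀ ≤ effSize d β γ nP nQ →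
      c ≤ weightP d β γ nP nQ ^ 2 * numP d β γ nP nQ +
        weightQ d β γ nP nQ ^ 2 * numQ d β γ nP nQ := by
  have hd : (0 : ℝ) ≤ d := Nat.cast_nonneg d
  set D : ℝ := 2 * β + d with hD
  set D' : ℝ := 2 * γ * β + d with hD'
  have hDpos : 0 < D := by positivity
  have hD'pos : 0 < D' := by positivity
  set b : ℝ := 2 ^ (D' / D) with hb
  have hbpos : 0 < b := by positivity
  -- The two thresholds make n N^(-d/D) at least 1 for the dominant sample, so that rounding down
  -- loses at most a factor 2. The constant b is the loss from raising N/2 to the power D'/D.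
  refine ⟨max (2 ^ (D / (2 * β))) (b ^ (D / (2 * γ * β))), min (1 / 4) (b⁻¹ / 2), by positivity,
    by positivity, fun nP nQ hN => ?_⟩
  set N := effSize d β γ nP nQ with hNdef
  have hNpos : 0 < N := lt_of_lt_of_le (by positivity) hN
  rcases le_total (N / 2) nQ with hcase | hcase
  · have h2 : 2 ≤ N ^ (2 * β / D) := by
      calc (2 : ℝ) = (2 ^ (D / (2 * β))) ^ (2 * β / D) := by
            rw [← Real.rpow_mul (by positivity)]
            have : D / (2 * β) * (2 * β / D) = 1 := by field_simp
            rw [this, Real.rpow_one]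
        _ ≤ N ^ (2 * β / D) := by
            refine Real.rpow_le_rpow (by positivity) ((le_max_left _ _).trans hN) (by positivity)
    have hy : N ^ (2 * β / D) / 2 ≤ nQ * N ^ (-(d / D)) := by
      calc N ^ (2 * β / D) / 2 = N / 2 * N ^ (-(d / D)) := by
            have : 2 * β / D = 1 + -(d / D) := by field_simp; rw [hD]; ring
            rw [this, Real.rpow_add hNpos, Real.rpow_one]; ring
        _ ≤ _ := by gcongr
    have hw : weightQ d β γ nP nQ ^ 2 = N ^ (-(2 * β / D)) := by
      rw [weightQ, ← Real.rpow_natCast, ← Real.rpow_mul hNpos.le]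
      congr 1
      push_cast
      ring
    have hfl : 1 / 2 / 2 ≤ weightQ d β γ nP nQ ^ 2 * (numQ d β γ nP nQ : ℝ) := by
      refine half_le_sq_mul_floor (by linarith) ?_
      calc (1 : ℝ) / 2 = N ^ (-(2 * β / D)) * (N ^ (2 * β / D) / 2) := by
            rw [Real.rpow_neg hNpos.le]; field_simp
        _ ≤ _ := by rw [hw]; exact mul_le_mul_of_nonneg_left hy (by positivity)
    have h0 : 0 ≤ weightP d β γ nP nQ ^ 2 * (numP d β γ nP nQ : ℝ) := by positivity
    have := min_le_left (1 / 4 : ℝ) (b⁻¹ / 2)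
    linarith
  · have hcase' : N / 2 ≤ (nP : ℝ) ^ (D / D') := by
      have : N = (nP : ℝ) ^ (D / D') + nQ := rfl
      linarith
    have hnP : N ^ (D' / D) / b ≤ nP := by
      calc N ^ (D' / D) / b = (N / 2) ^ (D' / D) := by
            rw [Real.div_rpow hNpos.le (by positivity)]
        _ ≤ ((nP : ℝ) ^ (D / D')) ^ (D' / D) :=
            Real.rpow_le_rpow (by positivity) hcase' (by positivity)
        _ = nP := by
            rw [← Real.rpow_mul (by positivity)]
            have : D / D' * (D' / D) = 1 := by field_simp
            rw [this, Real.rpow_one]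
    have h2 : b ≤ N ^ (2 * γ * β / D) := by
      calc b = (b ^ (D / (2 * γ * β))) ^ (2 * γ * β / D) := by
            rw [← Real.rpow_mul (by positivity)]
            have : D / (2 * γ * β) * (2 * γ * β / D) = 1 := by field_simp
            rw [this, Real.rpow_one]
        _ ≤ N ^ (2 * γ * β / D) := by
            refine Real.rpow_le_rpow (by positivity) ((le_max_right _ _).trans hN) (by positivity)
    have hy : N ^ (2 * γ * β / D) / b ≤ nP * N ^ (-(d / D)) := by
      calc N ^ (2 * γ * β / D) / b = N ^ (D' / D) / b * N ^ (-(d / D)) := by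
            have : 2 * γ * β / D = D' / D + -(d / D) := by field_simp; rw [hD']; ring
            rw [this, Real.rpow_add hNpos]; ring
        _ ≤ _ := by gcongr
    have hw : weightP d β γ nP nQ ^ 2 = N ^ (-(2 * γ * β / D)) := by
      rw [weightP, ← Real.rpow_natCast, ← Real.rpow_mul hNpos.le]
      congr 1
      push_cast
      ring
    have hfl : b⁻¹ / 2 ≤ weightP d β γ nP nQ ^ 2 * (numP d β γ nP nQ : ℝ) := by
      refine half_le_sq_mul_floor (((one_le_div hbpos).mpr h2).trans hy) ?_
      calc b⁻¹ = N ^ (-(2 * γ * β / D)) * (N ^ (2 * γ * β / D) / b) := by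
            rw [Real.rpow_neg hNpos.le]; field_simp
        _ ≤ _ := by rw [hw]; exact mul_le_mul_of_nonneg_left hy (by positivity)
    have h0 : 0 ≤ weightQ d β γ nP nQ ^ 2 * (numQ d β γ nP nQ : ℝ) := by positivity
    have := min_le_right (1 / 4 : ℝ) (b⁻¹ / 2)
    linarith

/-- One term u^n / n! of the exponential series, with n ≥ m/κ, already dominates T^m. -/
lemma exists_exp_neg_rpow_le {c κ m : ℝ} (hc : 0 < c) (hκ : 0 < κ) :
    ∃ K : ℝ, 0 < K ∧ ∀ T : ℝ, 1 ≤ T → Real.exp (-(c * T ^ κ)) ≤ K * T ^ (-m) := by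
  obtain ⟨n, hn⟩ := exists_nat_ge (m / κ)
  refine ⟨n.factorial / c ^ n, by positivity, fun T hT => ?_⟩
  have hT0 : 0 < T := by linarith
  have h1 := Real.pow_div_factorial_le_exp (c * T ^ κ) (by positivity) n
  have h2 : T ^ m ≤ (T ^ κ) ^ n := by
    rw [← Real.rpow_mul_natCast hT0.le]
    refine Real.rpow_le_rpow_of_exponent_le hT ?_
    rw [div_le_iff₀ hκ] at hn
    linarith
  have h3 : 0 < c ^ n * T ^ m / n.factorial := by positivity
  calc Real.exp (-(c * T ^ κ)) = (Real.exp (c * T ^ κ))⁻¹ := Real.exp_neg _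
    _ ≤ (c ^ n * T ^ m / n.factorial)⁻¹ := by
        refine inv_anti₀ h3 (le_trans ?_ h1)
        rw [mul_pow]
        gcongr
    _ = _ := by
        rw [Real.rpow_neg hT0.le, inv_div]
        field_simp

end Rates

/-! ### Consequences of membership in the class -/

section Class

variable {d : ℕ}

lemma DensityBounds.mul_volume_le {μm μp : ℝ} (hμ : 0 ≤ μm) {ν : Measure (Feat d)}
    [IsProbabilityMeasure ν] (h : DensityBounds μm μp ν) {B : Set (Feat d)}
    (hB : MeasurableSet B) :
    μm * volume.real (ν.support ∩ B) ≤ ν.real B := by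
  have hsup : MeasurableSet ν.support := Measure.isClosed_support.measurableSet
  have hle : ENNReal.ofReal μm * volume (ν.support ∩ B) ≤ ν B := by
    calc ENNReal.ofReal μm * volume (ν.support ∩ B)
        = ∫⁻ _ in B, ENNReal.ofReal μm ∂(volume.restrict ν.support) := by
          rw [setLIntegral_const, Measure.restrict_apply hB, Set.inter_comm]
      _ ≤ ∫⁻ x in B, ν.rnDeriv volume x ∂(volume.restrict ν.support) :=
          lintegral_mono_ae (ae_restrict_of_ae (h.2.mono fun x hx => hx.1.le))
      _ ≤ ∫⁻ x in B, ν.rnDeriv volume x ∂volume :=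
          lintegral_mono' (Measure.restrict_mono le_rfl Measure.restrict_le_self) le_rfl
      _ ≤ ν B := Measure.setLIntegral_rnDeriv_le B
  have := ENNReal.toReal_mono (measure_ne_top ν B) hle
  rwa [ENNReal.toReal_mul, ENNReal.toReal_ofReal hμ] at this

lemma volume_real_closedBall (x : Feat d) {r : ℝ} (hr : 0 ≤ r) :
    volume.real (Metric.closedBall x r) =
      r ^ d * volume.real (Metric.ball (0 : Feat d) 1) := by
  have := Measure.addHaar_real_closedBall (volume : Measure (Feat d)) x hr
  simpa using this

lemma StrongDensity.pow_le {μm μp cμ rμ : ℝ} (hμ : 0 ≤ μm) {νP νQ : Measure (Feat d)}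
    [IsProbabilityMeasure νP] [IsProbabilityMeasure νQ] (h : StrongDensity μm μp cμ rμ νP νQ)
    {x : Feat d} (hx : x ∈ νQ.support) {r : ℝ} (hr0 : 0 < r) (hr : r ≤ rμ) :
    μm * cμ * volume.real (Metric.ball (0 : Feat d) 1) * r ^ d ≤
        νP.real (Metric.closedBall x r) ∧
      μm * cμ * volume.real (Metric.ball (0 : Feat d) 1) * r ^ d ≤
        νQ.real (Metric.closedBall x r) := by
  have hm : MeasurableSet (Metric.closedBall x r) := Metric.isClosed_closedBall.measurableSet
  have h1 := mul_le_mul_of_nonneg_left (h.regular x hx r hr0 hr) hμ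
  rw [volume_real_closedBall x hr0.le] at h1
  have h2 := h.densityP.mul_volume_le hμ hm
  have h3 := h.densityQ.mul_volume_le hμ hm
  rw [h.support_eq] at h2
  constructor <;> linarith

end Class

/-! ### The probability of a wrong decision at a fixed point -/

section Pointwise

variable {d nP nQ : ℕ} {P Q : Measure (Feat d × Bool)} {ηP ηQ : Feat d → ℝ}

/-- The sign of `p - 1/2`. -/
def signHalf (p : ℝ) : ℝ := if 1 / 2 < p then 1 else -1

lemma signHalf_eq (p : ℝ) : signHalf p = 1 ∨ signHalf p = -1 := by
  unfold signHalf; split_ifs <;> simp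

lemma signHalf_mul (p : ℝ) : signHalf p * (p - 1 / 2) = |p - 1 / 2| := by
  unfold signHalf
  split_ifs with h
  · rw [abs_of_nonneg (by linarith), one_mul]
  · rw [abs_of_nonpos (by linarith), neg_one_mul]

lemma abs_eq_signHalf_mul {p q : ℝ} (hq : 0 < signHalf p * (q - 1 / 2)) {u : ℝ}
    (hu : 0 ≤ (u - 1 / 2) * (q - 1 / 2)) : |u - 1 / 2| = signHalf p * (u - 1 / 2) := by
  rcases signHalf_eq p with h | h <;> rw [h] at hq ⊢
  · rw [abs_of_nonneg (by nlinarith), one_mul]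
  · rw [abs_of_nonpos (by nlinarith), neg_one_mul]

/-- Reduces misclassification to the sign of the centred vote. The weak inequality covers ties, and
also the case without neighbours, where the vote is 0. -/
lemma vote_nonpos_of_ne {wP wQ : ℝ} (hwP : 0 < wP) (hwQ : 0 < wQ) {kP kQ : ℕ}
    {zP : Fin nP → Feat d × Bool} {zQ : Fin nQ → Feat d × Bool} {x : Feat d} {η : Feat d → ℝ}
    (h : knnClassifier wP wQ kP kQ zP zQ x ≠ bayesClassifier η x) :
    signHalf (η x) * (wP * (nearestLabelSum kP zP x - kP / 2) +
      wQ * (nearestLabelSum kQ zQ x - kQ / 2)) ≤ 0 := by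
  have hkP : (0 : ℝ) ≤ kP := Nat.cast_nonneg kP
  have hkQ : (0 : ℝ) ≤ kQ := Nat.cast_nonneg kQ
  have hD : 0 ≤ wP * kP + wQ * kQ := by positivity
  have hzero : wP * kP + wQ * kQ = 0 → wP * (nearestLabelSum kP zP x - kP / 2) +
      wQ * (nearestLabelSum kQ zQ x - kQ / 2) = 0 := by
    intro h0
    have h1 : wP * kP = 0 := by nlinarith [mul_nonneg hwP.le hkP, mul_nonneg hwQ.le hkQ]
    have h2 : wQ * kQ = 0 := by linarith
    have h3 : kP = 0 := by simpa [hwP.ne'] using h1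
    have h4 : kQ = 0 := by simpa [hwQ.ne'] using h2
    subst h3 h4
    simp [nearestLabelSum]
  rcases hD.eq_or_lt' with h0 | h0
  · rw [hzero h0, mul_zero]
  · rw [knnClassifier, bayesClassifier, ne_eq, decide_eq_decide, knnEstimator,
      lt_div_iff₀ h0] at h
    unfold signHalf
    split_ifs with hη
    · have : ¬ 1 / 2 * (wP * kP + wQ * kQ) <
          wP * nearestLabelSum kP zP x + wQ * nearestLabelSum kQ zQ x := fun h' =>
        h (iff_of_true h' hη)
      linarith
    · have : 1 / 2 * (wP * kP + wQ * kQ) <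
          wP * nearestLabelSum kP zP x + wQ * nearestLabelSum kQ zQ x := by
        by_contra h'
        exact h (iff_of_false h' hη)
      linarith

/-- The bound is uniform in n: for k = 0 the event is empty, and for k ≥ 1 the Chernoff bound with q
= Ak gives exp(-Ak/10) ≤ exp(-A/10). -/
lemma measure_countNear_lt_floor_le [IsProbabilityMeasure P] {n : ℕ} {x : Feat d} {r y A : ℝ}
    (hball : A * y ≤ P.fst.real (Metric.closedBall x r)) (hy : 0 ≤ y) (hA : 2 ≤ A) :
    (Measure.pi fun _ : Fin n => P) {z | countNear r x z < ⌊n * y⌋₊} ≤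
      ENNReal.ofReal (Real.exp (-(A / 10))) := by
  rcases Nat.eq_zero_or_pos ⌊n * y⌋₊ with h0 | h0
  · simp [h0]
  · have hk1 : (1 : ℝ) ≤ ⌊n * y⌋₊ := by exact_mod_cast h0
    have hk : (⌊n * y⌋₊ : ℝ) ≤ n * y := Nat.floor_le (by positivity)
    refine (measure_countNear_lt_le (q := A * ⌊n * y⌋₊) x ?_ (by gcongr)).trans
      (ENNReal.ofReal_le_ofReal (Real.exp_le_exp.mpr ?_))
    · calc A * ⌊n * y⌋₊ ≤ A * (n * y) := by gcongr
        _ = n * (A * y) := by ring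
        _ ≤ _ := by gcongr
    · nlinarith

variable {α Cα β Cβ γ Cγ μm μp cμ rμ : ℝ}

lemma InClass.half_le_signHalf_mul (h : InClass α Cα β Cβ γ Cγ μm μp cμ rμ P Q ηP ηQ)
    (hβ : 0 < β) (hCβ : 0 < Cβ) {x : Feat d} (hx : x ∈ Q.fst.support) {r : ℝ}
    (hr : Cβ * r ^ β ≤ |ηQ x - 1 / 2| / 2) {u : Feat d} (hu : u ∈ Q.fst.support)
    (hur : ‖u - x‖ ≤ r) : |ηQ x - 1 / 2| / 2 ≤ signHalf (ηQ x) * (ηQ u - 1 / 2) := by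
  have h1 : |ηQ u - ηQ x| ≤ Cβ * r ^ β := (h.smooth u hu x hx).trans (by gcongr)
  have h2 := signHalf_mul (ηQ x)
  have h3 := abs_le.mp (h1.trans hr)
  rcases signHalf_eq (ηQ x) with hs | hs <;> rw [hs] at h2 ⊢ <;> linarith [h3.1, h3.2]

lemma InClass.rpow_le_signHalf_mul (h : InClass α Cα β Cβ γ Cγ μm μp cμ rμ P Q ηP ηQ)
    (hγ : 0 < γ) (hCγ : 0 < Cγ) {x u : Feat d} (hu : u ∈ Q.fst.support)
    {s : ℝ} (hs : 0 < s) (hsu : s ≤ signHalf (ηQ x) * (ηQ u - 1 / 2)) :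
    Cγ * s ^ γ ≤ signHalf (ηQ x) * (ηP u - 1 / 2) := by
  obtain ⟨h1, h2⟩ := h.signal u (Or.inr hu)
  have hpos := hs.trans_le hsu
  rw [← abs_eq_signHalf_mul hpos h1]
  refine le_trans ?_ h2
  have h3 : s ≤ |ηQ u - 1 / 2| := by
    rw [abs_eq_signHalf_mul hpos (mul_self_nonneg _)]; exact hsu
  gcongr

lemma weightP_eq_weightQ_rpow (hN : 0 ≤ effSize d β γ nP nQ) :
    weightP d β γ nP nQ = weightQ d β γ nP nQ ^ γ := by
  rw [weightP, weightQ, ← Real.rpow_mul hN]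
  congr 1
  ring

/-- The value t = 2v minimises the exponent when the signal is exactly vw. One v serves both
samples, as each weight is matched to its signal. -/
lemma mul_hoeffding_exponent_le (k : ℕ) {v w s : ℝ} (hw : 0 ≤ v * w) (hs : v * w ≤ s) :
    (k : ℝ) * ((2 * v * w) ^ 2 / 8 - 2 * v * w * s / 2) ≤ -(w ^ 2 * k * (v ^ 2 / 2)) := by
  have h1 := mul_le_mul_of_nonneg_left (mul_le_mul_of_nonneg_left hs hw)
    (Nat.cast_nonneg (α := ℝ) k)
  linarith

/-- Away from the decision boundary, the two-sample classifier agrees with the Bayes classifier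
with probability exponentially close to one in the ratio of the signal to the weight `weightQ`. -/
lemma InClass.sampleLaw_ne_le [IsProbabilityMeasure P] [IsProbabilityMeasure Q]
    (h : InClass α Cα β Cβ γ Cγ μm μp cμ rμ P Q ηP ηQ)
    (hβ : 0 < β) (hCβ : 0 < Cβ) (hγ : 0 < γ) (hCγ : 0 < Cγ) (hμ : 0 < μm)
    (hn : 1 ≤ nP + nQ) {c A a b T : ℝ} (hc : 0 < c) (hcβ : Cβ * c ^ β ≤ 1 / 2) (hcr : c ≤ rμ)
    (hA : A = μm * cμ * volume.real (Metric.ball (0 : Feat d) 1) * c ^ d)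
    (ha0 : 0 < a) (ha : a ≤ 1 / 2) (haγ : a ≤ Cγ * (1 / 2) ^ γ)
    (hb : b ≤ weightP d β γ nP nQ ^ 2 * numP d β γ nP nQ +
        weightQ d β γ nP nQ ^ 2 * numQ d β γ nP nQ)
    {x : Feat d} (hx : x ∈ Q.fst.support) (hT : T = |ηQ x - 1 / 2| / weightQ d β γ nP nQ)
    (hT1 : 1 ≤ T) (hTA : 2 ≤ A * T ^ (d / β)) :
    sampleLaw nP nQ P Q {z | fNN β γ z.1 z.2 x ≠ bayesClassifier ηQ x} ≤
      ENNReal.ofReal (2 * Real.exp (-(A / 10 * T ^ (d / β))) +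
        Real.exp (-(b * a ^ 2 / 2 * T ^ (2 * min 1 γ)))) := by
  have hd : (0 : ℝ) ≤ d := Nat.cast_nonneg d
  have hT0 : 0 < T := by linarith
  set N := effSize d β γ nP nQ with hN
  have hN1 : 1 ≤ N := one_le_effSize hβ hγ hn
  have hN0 : 0 < N := by linarith
  set δ := weightQ d β γ nP nQ with hδ
  set ζ := |ηQ x - 1 / 2| with hζ
  have hδ0 : 0 < δ := Real.rpow_pos_of_pos hN0 _
  have hζT : ζ = T * δ := by rw [hT]; field_simp
  have hζ0 : 0 < ζ := by rw [hζT]; positivity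
  have hζ1 : ζ ≤ 1 / 2 := by
    have := h.regressionQ.mem_Icc x
    rw [hζ, abs_le]; constructor <;> linarith [this.1, this.2]
  have hwP : weightP d β γ nP nQ = δ ^ γ := weightP_eq_weightQ_rpow hN0.le
  -- At this radius η_Q varies by at most ζ/2, since Cβ c^β ≤ 1/2.
  set r := c * ζ ^ (1 / β) with hr
  have hr0 : 0 < r := by positivity
  have hrμ : r ≤ rμ := by
    refine le_trans ?_ hcr
    exact mul_le_of_le_one_right hc.le (Real.rpow_le_one hζ0.le (by linarith) (by positivity))
  have hrβ : Cβ * r ^ β ≤ ζ / 2 := by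
    rw [hr, Real.mul_rpow hc.le (by positivity), ← Real.rpow_mul hζ0.le, one_div,
      inv_mul_cancel₀ hβ.ne', Real.rpow_one, ← mul_assoc]
    nlinarith
  have hball : A * T ^ (d / β) * N ^ (-((d : ℝ) / (2 * β + d))) =
      μm * cμ * volume.real (Metric.ball (0 : Feat d) 1) * r ^ d := by
    have h1 : (ζ ^ (1 / β)) ^ d = T ^ (d / β) * N ^ (-((d : ℝ) / (2 * β + d))) := by
      rw [← Real.rpow_mul_natCast hζ0.le, hζT, Real.mul_rpow hT0.le hδ0.le, hδ, weightQ,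
        ← Real.rpow_mul hN0.le]
      congr 2
      · ring
      · field_simp
    rw [hr, mul_pow, h1, hA]
    ring
  obtain ⟨hbP, hbQ⟩ := h.density.pow_le hμ.le hx hr0 hrμ
  rw [← hball] at hbP hbQ
  have hsigQ : ∀ u ∈ Q.fst.support, ‖u - x‖ ≤ r → ζ / 2 ≤ signHalf (ηQ x) * (ηQ u - 1 / 2) :=
    fun u hu hur => h.half_le_signHalf_mul hβ hCβ hx hrβ hu hur
  have hsigP : ∀ u ∈ P.fst.support, ‖u - x‖ ≤ r →
      Cγ * (ζ / 2) ^ γ ≤ signHalf (ηQ x) * (ηP u - 1 / 2) := by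
    intro u hu hur
    rw [h.density.support_eq] at hu
    exact h.rpow_le_signHalf_mul hγ hCγ hu (by positivity) (hsigQ u hu hur)
  -- Evaluating the signal bound at x itself; this yields t w_P ≤ 2, the range allowed by the moment
  -- bound.
  have haP1 : Cγ * (ζ / 2) ^ γ ≤ 1 / 2 := by
    refine (hsigP x (by rwa [h.density.support_eq]) (by simpa using hr0.le)).trans ?_
    have := h.regressionP.mem_Icc x
    rcases signHalf_eq (ηQ x) with hs | hs <;> rw [hs] <;> linarith [this.1, this.2]
  -- Relative to the weights the Q-signal grows like T and the P-signal like T^γ; τ is below both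
  -- since T ≥ 1.
  set τ := T ^ min 1 γ with hτ
  have hτ0 : 0 < τ := by positivity
  have hτ1 : τ ≤ T := by
    calc τ ≤ T ^ (1 : ℝ) := Real.rpow_le_rpow_of_exponent_le hT1 (min_le_left _ _)
      _ = T := Real.rpow_one T
  have hτγ : τ ≤ T ^ γ := Real.rpow_le_rpow_of_exponent_le hT1 (min_le_right _ _)
  have hτ2 : τ ^ 2 = T ^ (2 * min 1 γ) := by
    rw [hτ, ← Real.rpow_mul_natCast hT0.le]
    congr 1
    push_cast
    ring
  have haQ' : a * τ * δ ≤ ζ / 2 := by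
    rw [hζT]
    calc a * τ * δ ≤ 1 / 2 * T * δ := by gcongr
      _ = T * δ / 2 := by ring
  have haP' : a * τ * δ ^ γ ≤ Cγ * (ζ / 2) ^ γ := by
    have : (ζ / 2) ^ γ = (1 / 2) ^ γ * T ^ γ * δ ^ γ := by
      rw [hζT, ← Real.mul_rpow (by positivity) hT0.le, ← Real.mul_rpow (by positivity) hδ0.le]
      congr 1; ring
    rw [this, ← mul_assoc, ← mul_assoc]
    gcongr
  have hwrong := sampleLaw_wrong_vote_le h.regressionP h.regressionQ
    (floor_mul_rpow_le hN1 (e := (d : ℝ) / (2 * β + d)) (by positivity) nP)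
    (floor_mul_rpow_le hN1 (e := (d : ℝ) / (2 * β + d)) (by positivity) nQ) x
    (signHalf_eq (ηQ x)) (by positivity) (by positivity) hsigP hsigQ
    (t := 2 * a * τ) (wP := δ ^ γ) (wQ := δ) (by positivity) (by positivity) hδ0.le
    (by linarith) (by linarith)
  have htP := measure_countNear_lt_floor_le (n := nP) hbP (by positivity) hTA
  have htQ := measure_countNear_lt_floor_le (n := nQ) hbQ (by positivity) hTA
  have hsub : {z : (Fin nP → Feat d × Bool) × (Fin nQ → Feat d × Bool) |
      fNN β γ z.1 z.2 x ≠ bayesClassifier ηQ x} ⊆ {z | signHalf (ηQ x) *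
        (δ ^ γ * (nearestLabelSum (numP d β γ nP nQ) z.1 x - (numP d β γ nP nQ : ℝ) / 2) +
        δ * (nearestLabelSum (numQ d β γ nP nQ) z.2 x - (numQ d β γ nP nQ : ℝ) / 2)) ≤ 0} := by
    intro z hz
    rw [← hwP]
    exact vote_nonpos_of_ne (Real.rpow_pos_of_pos hN0 _) hδ0 hz
  refine (measure_mono hsub).trans (hwrong.trans ?_)
  rw [two_mul (Real.exp _), ENNReal.ofReal_add (by positivity) (by positivity),
    ENNReal.ofReal_add (by positivity) (by positivity)]
  refine add_le_add (add_le_add (htP.trans_eq ?_) (htQ.trans_eq ?_)) ?_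
  · congr 3; ring
  · congr 3; ring
  · refine ENNReal.ofReal_le_ofReal (Real.exp_le_exp.mpr ?_)
    change (numP d β γ nP nQ : ℝ) * _ + (numQ d β γ nP nQ : ℝ) * _ ≤ _
    rw [hwP] at hb
    have k1 := mul_hoeffding_exponent_le (numP d β γ nP nQ) (v := a * τ) (by positivity) haP'
    have k2 := mul_hoeffding_exponent_le (numQ d β γ nP nQ) (v := a * τ) (by positivity) haQ'
    have k3 := mul_le_mul_of_nonneg_right hb (by positivity : 0 ≤ a ^ 2 * τ ^ 2 / 2)
    rw [mul_assoc 2 a τ, ← hτ2]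
    rw [mul_pow] at k1 k2
    linarith

end Pointwise

/-- The probability that the classifier differs from the Bayes classifier at a point decays
polynomially, of any given order, in the ratio of the signal to the weight `weightQ`. -/
lemma exists_sampleLaw_ne_le (d : ℕ) (hd : 1 ≤ d) {α Cα β Cβ γ Cγ μm μp cμ rμ : ℝ}
    (hβ : 0 < β) (hCβ : 0 < Cβ) (hγ : 0 < γ) (hCγ : 0 < Cγ) (hμ : 0 < μm) (hcμ : 0 < cμ)
    (hrμ : 0 < rμ) {m : ℝ} (hm : 0 ≤ m) :
    ∃ K : ℝ, 1 ≤ K ∧ ∀ nP nQ : ℕ, 1 ≤ nP + nQ →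
      ∀ (P Q : Measure (Feat d × Bool)) [IsProbabilityMeasure P] [IsProbabilityMeasure Q]
        (ηP ηQ : Feat d → ℝ), InClass α Cα β Cβ γ Cγ μm μp cμ rμ P Q ηP ηQ →
      ∀ x ∈ Q.fst.support, 0 < |ηQ x - 1 / 2| →
        sampleLaw nP nQ P Q {z | fNN β γ z.1 z.2 x ≠ bayesClassifier ηQ x} ≤
          ENNReal.ofReal (K * (|ηQ x - 1 / 2| / weightQ d β γ nP nQ) ^ (-m)) := by
  have hd0 : (0 : ℝ) < d := by exact_mod_cast hd
  set c := min ((1 / (2 * Cβ)) ^ (1 / β)) rμ with hc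
  have hc0 : 0 < c := by positivity
  have hcβ : Cβ * c ^ β ≤ 1 / 2 := by
    calc Cβ * c ^ β ≤ Cβ * ((1 / (2 * Cβ)) ^ (1 / β)) ^ β := by gcongr; exact min_le_left _ _
      _ = 1 / 2 := by
        rw [← Real.rpow_mul (by positivity), one_div β, inv_mul_cancel₀ hβ.ne', Real.rpow_one]
        field_simp
  set A := μm * cμ * volume.real (Metric.ball (0 : Feat d) 1) * c ^ d with hA
  have hV : 0 < volume.real (Metric.ball (0 : Feat d) 1) :=
    ENNReal.toReal_pos (Metric.measure_ball_pos _ _ one_pos).ne' measure_ball_lt_top.ne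
  have hA0 : 0 < A := by positivity
  set a := min (1 / 2) (Cγ * (1 / 2) ^ γ) with ha
  have ha0 : 0 < a := by positivity
  obtain ⟨N₀, b, hN₀, hb0, hb⟩ := exists_le_sum_sq_weights d hβ hγ
  obtain ⟨K₁, hK₁, hexp₁⟩ := exists_exp_neg_rpow_le (c := A / 10) (κ := d / β) (m := m)
    (by positivity) (by positivity)
  obtain ⟨K₂, hK₂, hexp₂⟩ := exists_exp_neg_rpow_le (c := b * a ^ 2 / 2) (κ := 2 * min 1 γ)
    (m := m) (by positivity) (by positivity)
  -- Above T₀ three things hold: T ≥ 1, the ball mass suffices for the Chernoff bound, and N ≥ N₀.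
  -- Below it, the term T₀^m in K makes the claim trivial.
  set T₀ := max 1 (max ((2 / A) ^ (β / d)) (N₀ ^ (β / (2 * β + d)))) with hT₀
  have hT₀1 : 1 ≤ T₀ := le_max_left _ _
  refine ⟨T₀ ^ m + 2 * K₁ + K₂, ?_, ?_⟩
  · have := Real.one_le_rpow hT₀1 hm
    linarith
  intro nP nQ hn P Q _ _ ηP ηQ h x hx hζ0
  have hN1 : 1 ≤ effSize d β γ nP nQ := one_le_effSize hβ hγ hn
  have hN0 : 0 < effSize d β γ nP nQ := by linarith
  have hδ0 : 0 < weightQ d β γ nP nQ := Real.rpow_pos_of_pos hN0 _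
  set T := |ηQ x - 1 / 2| / weightQ d β γ nP nQ with hT
  have hT0 : 0 < T := by positivity
  rcases le_total T T₀ with hle | hle
  · have hprob : IsProbabilityMeasure (sampleLaw nP nQ P Q) := by
      unfold sampleLaw; infer_instance
    refine prob_le_one.trans ?_
    rw [ENNReal.one_le_ofReal]
    have h1 : T₀ ^ (-m) ≤ T ^ (-m) :=
      Real.rpow_le_rpow_of_nonpos hT0 hle (by linarith)
    calc (1 : ℝ) = T₀ ^ m * T₀ ^ (-m) := by
          rw [← Real.rpow_add (by linarith), add_neg_cancel, Real.rpow_zero]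
      _ ≤ (T₀ ^ m + 2 * K₁ + K₂) * T ^ (-m) := by
          gcongr
          linarith
  · have hT1 : 1 ≤ T := hT₀1.trans hle
    have hTA : 2 ≤ A * T ^ (d / β) := by
      have h1 : (2 / A) ^ (β / d) ≤ T :=
        ((le_max_left _ _).trans (le_max_right _ _)).trans hle
      have h2 := Real.rpow_le_rpow (by positivity) h1 (by positivity : 0 ≤ d / β)
      rw [← Real.rpow_mul (by positivity)] at h2
      have h3 : β / d * (d / β) = 1 := by field_simp
      rw [h3, Real.rpow_one, div_le_iff₀ hA0] at h2
      linarith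
    -- Signals are bounded by 1, so a large ratio T forces a large effective sample size.
    have hNN : N₀ ≤ effSize d β γ nP nQ := by
      have h1 : N₀ ^ (β / (2 * β + d)) ≤ T :=
        ((le_max_right _ _).trans (le_max_right _ _)).trans hle
      have h2 : T ≤ effSize d β γ nP nQ ^ (β / (2 * β + d)) := by
        have h3 : |ηQ x - 1 / 2| ≤ 1 := by
          have := h.regressionQ.mem_Icc x
          rw [abs_le]; constructor <;> linarith [this.1, this.2]
        rw [hT, weightQ, Real.rpow_neg hN0.le, div_inv_eq_mul]
        exact mul_le_of_le_one_left (by positivity) h3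
      exact (Real.rpow_le_rpow_iff hN₀.le hN0.le (by positivity)).mp (h1.trans h2)
    refine (h.sampleLaw_ne_le hβ hCβ hγ hCγ hμ hn hc0 hcβ (min_le_right _ _) hA ha0
      (min_le_left _ _) (min_le_right _ _) (hb nP nQ hNN) hx hT hT1 hTA).trans
      (ENNReal.ofReal_le_ofReal ?_)
    have h1 := hexp₁ T hT1
    have h2 := hexp₂ T hT1
    have h3 : 0 ≤ T₀ ^ m * T ^ (-m) := by positivity
    linarith

end PosteriorDrift

end

/-! ### The upper bound on the expected excess risk -/

theorem theorem1 (d : ℕ) (hd : 1 ≤ d) (α Cα β Cβ γ Cγ μm μp cμ rμ : ℝ)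
    (hα : 0 ≤ α) (hCα : 0 < Cα) (hβ0 : 0 < β) (hβ1 : β ≤ 1) (hCβ : 0 < Cβ)
    (hγ : 0 < γ) (hCγ : 0 < Cγ) (hμ : 0 < μm) (hcμ : 0 < cμ) (hrμ : 0 < rμ) :
    ∃ C : ℝ, 0 < C ∧ ∀ nP nQ : ℕ, 1 ≤ nP + nQ →
      ∀ (P Q : Measure (PosteriorDrift.Feat d × Bool)),
        IsProbabilityMeasure P → IsProbabilityMeasure Q →
      ∀ ηP ηQ : PosteriorDrift.Feat d → ℝ,
        PosteriorDrift.InClass α Cα β Cβ γ Cγ μm μp cμ rμ P Q ηP ηQ →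
        Integrable (fun z => PosteriorDrift.excessRisk Q ηQ (PosteriorDrift.fNN β γ z.1 z.2))
          (PosteriorDrift.sampleLaw nP nQ P Q) ∧
        ∫ z, PosteriorDrift.excessRisk Q ηQ (PosteriorDrift.fNN β γ z.1 z.2)
            ∂(PosteriorDrift.sampleLaw nP nQ P Q)
          ≤ C * PosteriorDrift.effSize d β γ nP nQ ^ (-(β * (1 + α) / (2 * β + d))) := by
  obtain ⟨K, hK, hbound⟩ := PosteriorDrift.exists_sampleLaw_ne_le d hd (α := α) (Cα := Cα)
    (μp := μp) hβ0 hCβ hγ hCγ hμ hcμ hrμ (m := α + 2) (by linarith)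
  refine ⟨4 * 2 ^ (α + 2) * K * Cα, by positivity, fun nP nQ hn P Q _ _ ηP ηQ h => ?_⟩
  have hprob : IsProbabilityMeasure (PosteriorDrift.sampleLaw nP nQ P Q) := by
    unfold PosteriorDrift.sampleLaw; infer_instance
  have hN0 : 0 < PosteriorDrift.effSize d β γ nP nQ :=
    one_pos.trans_le (PosteriorDrift.one_le_effSize hβ0 hγ hn)
  have hmeas := PosteriorDrift.measurable_fNN (d := d) (nP := nP) (nQ := nQ) β γ
  refine ⟨PosteriorDrift.integrable_excessRisk h.regressionQ _ hmeas, ?_⟩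
  have hrate : PosteriorDrift.effSize d β γ nP nQ ^ (-(β * (1 + α) / (2 * β + d))) =
      PosteriorDrift.weightQ d β γ nP nQ ^ (1 + α) := by
    rw [PosteriorDrift.weightQ, ← Real.rpow_mul hN0.le]
    congr 1
    ring
  rw [hrate, ← ENNReal.ofReal_le_ofReal_iff (by
      have : 0 < PosteriorDrift.weightQ d β γ nP nQ := Real.rpow_pos_of_pos hN0 _
      positivity),
    PosteriorDrift.ofReal_integral_excessRisk h.regressionQ _ hmeas]
  refine h.margin.lintegral_le h.regressionQ.measurable hα hCα hK (Real.rpow_pos_of_pos hN0 _)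
    (fun x => prob_le_one) ?_
  -- The pointwise bound is available only on the support of Q_X, which has full measure.
  filter_upwards [Measure.support_mem_ae (μ := Q.fst)] with x hx hx0
  exact hbound nP nQ hn P Q ηP ηQ h x hx hx0
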